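/- **Setting.** Let $G_0$ be the complete graph on $\{(0,0),(1,0),(0,1)\}\subset\mathbb{Z}^2$ and let $G_{k+1}=\bigcup_{i=0}^{2}(G_k+a_{k,i})$ with $a_{k,0}=(0,0)$, $a_{k,1}=(2^k,0)$, $a_{k,2}=(0,2^k)$. Put $\mathsf{SG}^+=\bigcup_{k\ge 0}G_k$, and let $\mathsf{SG}=\mathsf{SG}^+\cup(-\mathsf{SG}^+)$ be the double-sided Sierpinski gasket graph (which is $4$-regular), with origin $o=(0,0)$, neighbourhood relation $\sim$, and balls $B_n$ of radius $n$ around $o$ in the graph metric (that is, $B_n=\{(x,y)\in\mathsf{SG}:|x|+|y|\le n\}$). For $f:\mathsf{SG}\to\mathbb{R}$ let $\Delta f(x)=\frac14\sum_{y\sim x}f(y)-f(x)$. Divisible sandpile (with maximal height $1$): for $\mu:\mathsf{SG}\to\mathbb{R}_{\ge 0}$ of finite support, toppling the vertex $x$ gives $T_x\mu=\mu+\max\{\mu(x)-1,0\}\,\Delta\delta_x$. Given an initial distribution $\mu_0$ and a sequence $(x_j)_{j\ge 1}$ of vertices that contains every vertex infinitely often (a toppling sequence), put $\mu_n=T_{x_n}\mu_{n-1}$;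 the odometer after $n$ topplings is the total mass emitted from each vertex, $y\mapsto\sum_{1\le j\le n,\;x_j=y}\big(\mu_{j-1}(y)-\mu_j(y)\big)$. The odometer function $u$ is the pointwise limit of these functions as $n\to\infty$; it does not depend on the toppling sequence. The sandpile cluster is $\{z\in\mathsf{SG}:u(z)>0\}$. **Theorem.** There is exactly one function $\tilde u:\mathsf{SG}^+\to\mathbb{R}$ such that $\tilde u(x,0)=0$ for all integers $x\ge 0$, $\tilde u(x,1)=2$ for all $x\ge 0$ with $(x,1)\in\mathsf{SG}^+$, and $\Delta\tilde u(x,y)=1$ for all $(x,y)\in\mathsf{SG}^+$ with $y\ge 1$ (all neighbours of such a vertex lie in $\mathsf{SG}^+$). For every integer $k\ge 0$ let $\psi_k(x,y)=(y,\,2^k-x-y)$. Then for every $k\ge 0$ the odometer function $u_k$ of the divisible sandpile on $\mathsf{SG}$ with initial mass distribution $\mu_0=3^{k+1}\delta_o$ exists (the limit exists for every toppling sequence, and is the same for all of them), and $$u_k(x,y)=\begin{cases}\tilde u\big(\psi_k(|x|,|y|)\big),&\text{if }(x,y)\in B_{2^k},\\ 0,&\text{otherwise.}\end{cases}$$ Moreover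 the sandpile cluster $\{z\in\mathsf{SG}:u_k(z)>0\}$ is equal to $B_{2^k-1}$. -/

import Mathlib

open Filter Topology

/-- The translation vectors `(0,0)`, `(2^k,0)`, `(0,2^k)`. -/
def gasketShift (k : ℕ) : Fin 3 → ℤ × ℤ :=
  ![(0, 0), ((2 : ℤ) ^ k, 0), (0, (2 : ℤ) ^ k)]

/-- The vertex set of the finite gasket graph `G_k`. -/
def gasketLevelVertices : ℕ → Set (ℤ × ℤ)
  | 0 => {(0, 0), (1, 0), (0, 1)}
  | k + 1 => ⋃ i : Fin 3, (fun z => z + gasketShift k i) '' gasketLevelVertices k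

/-- The edges of the finite gasket graph `G_k`, as a graph on the whole of `ℤ × ℤ`: `G_0` is the
complete graph on its three vertices, and `G_{k+1}` is the union of three translates of `G_k`. -/
def gasketLevel : ℕ → SimpleGraph (ℤ × ℤ)
  | 0 =>
    { Adj := fun u v => u ∈ gasketLevelVertices 0 ∧ v ∈ gasketLevelVertices 0 ∧ u ≠ v
      symm := ⟨fun _ _ h => ⟨h.2.1, h.1, h.2.2.symm⟩⟩
      loopless := ⟨fun _ h => h.2.2 rfl⟩ }
  | k + 1 => ⨆ i : Fin 3, (gasketLevel k).map (Equiv.addRight (gasketShift k i)).toEmbedding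

/-- The vertex set of the one-sided gasket `SG⁺`. -/
def gasketPlus : Set (ℤ × ℤ) := ⋃ k, gasketLevelVertices k

/-- The vertex set of the double-sided gasket `SG = SG⁺ ∪ (-SG⁺)`. -/
def gasketSet : Set (ℤ × ℤ) := {z | z ∈ gasketPlus ∨ -z ∈ gasketPlus}

/-- The vertices of the double-sided gasket, as a type. -/
abbrev Gasket : Type := ↥gasketSet

/-- The double-sided Sierpinski gasket graph `SG`: the union of `SG⁺` and of its mirror image. -/
def gasketGraph : SimpleGraph Gasket where
  Adj u v := (∃ k, (gasketLevel k).Adj u v) ∨ (∃ k, (gasketLevel k).Adj (-u) (-v))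
  symm := ⟨fun _ _ h => h.imp (fun ⟨k, h⟩ => ⟨k, h.symm⟩) (fun ⟨k, h⟩ => ⟨k, h.symm⟩)⟩
  loopless := ⟨fun _ h => h.elim (fun ⟨k, h⟩ => (gasketLevel k).irrefl h)
    (fun ⟨k, h⟩ => (gasketLevel k).irrefl h)⟩

theorem gasketLevel_adj_bound (k : ℕ) : ∀ u v : ℤ × ℤ, (gasketLevel k).Adj u v →
    (u.1 - 1 ≤ v.1 ∧ v.1 ≤ u.1 + 1) ∧ (u.2 - 1 ≤ v.2 ∧ v.2 ≤ u.2 + 1) := by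
  induction k with
  | zero =>
    rintro ⟨a, b⟩ ⟨c, d⟩ ⟨h1, h2, -⟩
    simp only [gasketLevelVertices, Set.mem_insert_iff, Set.mem_singleton_iff,
      Prod.mk.injEq] at h1 h2
    simp only
    omega
  | succ k ih =>
    intro u v h
    simp only [gasketLevel, SimpleGraph.iSup_adj, SimpleGraph.map_adj] at h
    obtain ⟨i, a, b, hab, rfl, rfl⟩ := h
    have := ih a b hab
    simp only [Equiv.coe_toEmbedding, Equiv.coe_addRight, Prod.fst_add, Prod.snd_add]
    omega

theorem gasketGraph_neighborSet_finite (u : Gasket) : (gasketGraph.neighborSet u).Finite := by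
  refine Set.Finite.of_finite_image (f := Subtype.val) ?_ Subtype.val_injective.injOn
  refine ((Set.finite_Icc (u.1.1 - 1) (u.1.1 + 1)).prod
    (Set.finite_Icc (u.1.2 - 1) (u.1.2 + 1))).subset ?_
  rintro _ ⟨v, hv, rfl⟩
  rcases hv with ⟨k, h⟩ | ⟨k, h⟩
  · have := gasketLevel_adj_bound k _ _ h
    simp only [Set.mem_prod, Set.mem_Icc]
    omega
  · have := gasketLevel_adj_bound k _ _ h
    simp only [Prod.fst_neg, Prod.snd_neg] at this
    simp only [Set.mem_prod, Set.mem_Icc]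
    omega

noncomputable instance gasketGraph_locallyFinite : gasketGraph.LocallyFinite :=
  fun u => (gasketGraph_neighborSet_finite u).fintype

/-- The origin `o = (0,0)` of the gasket. -/
def gasketOrigin : Gasket :=
  ⟨(0, 0), Or.inl (Set.mem_iUnion.2 ⟨0, by simp [gasketLevelVertices]⟩)⟩

/-- The closed ball `B_n` around the origin in the graph metric of `SG`. -/
noncomputable def gasketBall (n : ℕ) : Set Gasket :=
  {z | gasketGraph.edist gasketOrigin z ≤ (n : ℕ∞)}

/-- The graph Laplacian `Δ f (x) = (1/4) ∑_{y ∼ x} f y - f x`. -/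
noncomputable def gasketLaplacian (f : Gasket → ℝ) (x : Gasket) : ℝ :=
  (1 / 4) * ∑ y ∈ gasketGraph.neighborFinset x, f y - f x

/-- The point mass `δ_x`. -/
noncomputable def gasketDelta (x : Gasket) : Gasket → ℝ := Pi.single x 1

/-- The toppling operator `T_x μ = μ + max (μ x - 1, 0) Δ δ_x` (maximal height `1`). -/
noncomputable def topple (x : Gasket) (μ : Gasket → ℝ) : Gasket → ℝ :=
  μ + max (μ x - 1) 0 • gasketLaplacian (gasketDelta x)

/-- The sand distribution after toppling `x 0, …, x (n-1)`, in this order. -/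
noncomputable def sandAfter (x : ℕ → Gasket) (μ₀ : Gasket → ℝ) : ℕ → Gasket → ℝ
  | 0 => μ₀
  | n + 1 => topple (x n) (sandAfter x μ₀ n)

/-- The total mass emitted from `y` during the topplings of `x 0, …, x (n-1)`. -/
noncomputable def odometerAfter (x : ℕ → Gasket) (μ₀ : Gasket → ℝ) (n : ℕ) (y : Gasket) : ℝ :=
  ∑ j ∈ (Finset.range n).filter (fun j => x j = y), (sandAfter x μ₀ j y - sandAfter x μ₀ (j + 1) y)

/-- A toppling sequence contains every vertex infinitely often. -/
def IsTopplingSequence (x : ℕ → Gasket) : Prop :=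
  ∀ z : Gasket, {n | x n = z}.Infinite

/-- `u` is the odometer function of the divisible sandpile started from `μ₀`: for every toppling
sequence, the odometers after finitely many topplings converge pointwise to `u`. -/
def IsOdometer (μ₀ u : Gasket → ℝ) : Prop :=
  ∀ x : ℕ → Gasket, IsTopplingSequence x →
    ∀ z, Tendsto (fun n => odometerAfter x μ₀ n z) atTop (𝓝 (u z))

/-- The sandpile cluster belonging to an odometer function. -/
def sandpileCluster (u : Gasket → ℝ) : Set Gasket := {z | 0 < u z}

/-- The conditions that define `ũ : SG⁺ → ℝ`. A function on `SG⁺` is written as a function on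
`ℤ × ℤ`, whose values off `SG⁺` play no role: all neighbours of a vertex of `SG⁺` other than the
origin lie in `SG⁺`. -/
structure IsUTilde (f : ℤ × ℤ → ℝ) : Prop where
  row_zero : ∀ x : ℤ, 0 ≤ x → f (x, 0) = 0
  row_one : ∀ x : ℤ, 0 ≤ x → (x, 1) ∈ gasketPlus → f (x, 1) = 2
  laplacian_eq_one : ∀ z : Gasket, (z : ℤ × ℤ) ∈ gasketPlus → 1 ≤ (z : ℤ × ℤ).2 →
    gasketLaplacian (fun w : Gasket => f w) z = 1

/-- `ψ_k (x, y) = (y, 2^k - x - y)`. -/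
def gasketPsi (k : ℕ) (z : ℤ × ℤ) : ℤ × ℤ := (z.2, 2 ^ k - z.1 - z.2)

/-!
The gasket is self-similar: doubling every triangle of `SG⁺` and filling in the midpoints of its
sides gives `SG⁺` again. If `Δ f = 1` off the origin, then so it is for `p ↦ f (2 p) / 5`, and on
the doubled triangle with corners `2 p`, `2 q`, `2 r`, the three equations at the midpoints force
`f (p + q) = g p + g q + g r + g p + g q - 2`, where `g p = f (2 p) / 5`. Two functions satisfying
the conditions on `ũ` therefore agree, by induction on the distance to the origin; in particular
`ũ (2 p) = 5 ũ p`, and conversely these two rules define `ũ`.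

The map `ψ_k` rotates the triangle `G_k`, with the origin as a corner, by one third of a turn, and
sends the side opposite to the origin to the bottom row. Hence `ũ ∘ ψ_k`, extended to `SG` by
symmetry and by `0`, has Laplacian `1` at the interior vertices of `B_{2^k}` other than the origin,
and at most `1` outside. The contribution `L_k` of one triangle to its Laplacian at the origin
satisfies `L_{k+1} = 3 L_k - 4` by the subdivision rule, so the Laplacian there is
`1 - 3 ^ (k + 1)`.

This function `u` satisfies `3 ^ (k + 1) δ_o + Δ u ≤ 1`, with equality where `u > 0`. The finite
odometers increase and stay below every nonnegative function that satisfies the inequality (least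
action principle), and their limit `v` satisfies it as well. On the finite set `{u > 0}` this
makes `u - v` subharmonic, and the maximum principle gives `u ≤ v`.
-/

/-! ### Triangles of the gasket -/

/-- The corners of the upward unit triangle whose lower left corner is `c`. -/
def gasketTriangle (c : ℤ × ℤ) : Finset (ℤ × ℤ) := {c, c + (1, 0), c + (0, 1)}

theorem mem_gasketTriangle {c q : ℤ × ℤ} :
    q ∈ gasketTriangle c ↔ c.1 ≤ q.1 ∧ c.2 ≤ q.2 ∧ q.1 + q.2 ≤ c.1 + c.2 + 1 := by
  simp only [gasketTriangle, Finset.mem_insert, Finset.mem_singleton, Prod.ext_iff, Prod.fst_add,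
    Prod.snd_add]
  omega

theorem self_mem_gasketTriangle (c : ℤ × ℤ) : c ∈ gasketTriangle c :=
  Finset.mem_insert_self _ _

theorem card_gasketTriangle (c : ℤ × ℤ) : (gasketTriangle c).card = 3 :=
  Finset.card_eq_three.2 ⟨_, _, _, by simp, by simp, by simp, rfl⟩

theorem sum_gasketTriangle {M : Type*} [AddCommMonoid M] (f : ℤ × ℤ → M) (c : ℤ × ℤ) :
    ∑ q ∈ gasketTriangle c, f q = f c + (f (c + (1, 0)) + f (c + (0, 1))) := by
  rw [gasketTriangle, Finset.sum_insert (by simp), Finset.sum_pair (by simp)]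

theorem add_mem_gasketTriangle_add {c p q : ℤ × ℤ} :
    p + q ∈ gasketTriangle (c + p) ↔ q ∈ gasketTriangle c := by
  simp only [mem_gasketTriangle, Prod.fst_add, Prod.snd_add]
  omega

theorem sum_gasketTriangle_add {M : Type*} [AddCommMonoid M] (f : ℤ × ℤ → M) (c p : ℤ × ℤ) :
    ∑ q ∈ gasketTriangle (c + p), f q = ∑ q ∈ gasketTriangle c, f (p + q) := by
  simp only [sum_gasketTriangle, ← add_assoc, add_comm p c]

theorem add_right_mem_gasketTriangle_add_right {c p w : ℤ × ℤ} :
    p + w ∈ gasketTriangle (c + w) ↔ p ∈ gasketTriangle c := by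
  simp only [mem_gasketTriangle, Prod.fst_add, Prod.snd_add]
  omega

theorem sub_mem_gasketTriangle_sub {c p w : ℤ × ℤ} :
    p - w ∈ gasketTriangle (c - w) ↔ p ∈ gasketTriangle c := by
  simp only [mem_gasketTriangle, Prod.fst_sub, Prod.snd_sub]
  omega

/-- `GasketCell c` says that the unit triangle with lower left corner `c` is one of the triangles
that make up `SG⁺`. Since `SG⁺` doubled and then subdivided is `SG⁺` again, every triangle `c` gives
rise to the three triangles `c + p`, one at each of its (doubled) corners `p`. -/
inductive GasketCell : ℤ × ℤ → Prop
  | zero : GasketCell 0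
  | add {c p : ℤ × ℤ} : GasketCell c → p ∈ gasketTriangle c → GasketCell (c + p)

namespace GasketCell

variable {c p q : ℤ × ℤ}

theorem nonneg (h : GasketCell c) : 0 ≤ c.1 ∧ 0 ≤ c.2 := by
  induction h with
  | zero => simp
  | add _ hp ih =>
    rw [mem_gasketTriangle] at hp
    simp only [Prod.fst_add, Prod.snd_add]
    omega

theorem exists_eq_add (h : GasketCell c) :
    ∃ d, GasketCell d ∧ ∃ p ∈ gasketTriangle d, c = d + p := by
  cases h with
  | zero => exact ⟨0, zero, 0, self_mem_gasketTriangle 0, (add_zero 0).symm⟩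
  | add hd hp => exact ⟨_, hd, _, hp, rfl⟩

theorem natCast_zero (n : ℕ) : GasketCell ((n : ℤ), 0) := by
  induction n using Nat.strong_induction_on with
  | _ n ih =>
    rcases n.eq_zero_or_pos with rfl | hn
    · exact zero
    have half := ih (n / 2) (by omega)
    have corner : ((n : ℤ) - (n / 2 : ℕ), (0 : ℤ)) ∈ gasketTriangle (((n / 2 : ℕ) : ℤ), 0) :=
      mem_gasketTriangle.2 ⟨by dsimp only; omega, le_rfl, by dsimp only; omega⟩
    simpa using half.add corner

end GasketCell

/-- The lower left corners of the unit triangles of `G_k`. -/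
def gasketLevelCells (k : ℕ) : Set (ℤ × ℤ) := {c | GasketCell c ∧ c.1 + c.2 < 2 ^ k}

theorem gasketLevelCells_zero : gasketLevelCells 0 = {0} := by
  ext c
  constructor
  · rintro ⟨hc, hlt⟩
    have := hc.nonneg
    rw [pow_zero] at hlt
    exact Prod.ext (by simp only [Prod.fst_zero]; omega) (by simp only [Prod.snd_zero]; omega)
  · rintro rfl
    exact ⟨.zero, by simp⟩

theorem mem_gasketLevelCells_succ_iff {k : ℕ} {c : ℤ × ℤ} :
    c ∈ gasketLevelCells (k + 1) ↔
      ∃ d ∈ gasketLevelCells k, ∃ p ∈ gasketTriangle d, c = d + p := by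
  constructor
  · rintro ⟨hc, hlt⟩
    obtain ⟨d, hd, p, hp, rfl⟩ := hc.exists_eq_add
    refine ⟨d, ⟨hd, ?_⟩, p, hp, rfl⟩
    rw [mem_gasketTriangle] at hp
    simp only [Prod.fst_add, Prod.snd_add, pow_succ] at hlt
    omega
  · rintro ⟨d, ⟨hd, hlt⟩, p, hp, rfl⟩
    refine ⟨hd.add hp, ?_⟩
    rw [mem_gasketTriangle] at hp
    simp only [Prod.fst_add, Prod.snd_add, pow_succ]
    omega

theorem gasketShift_succ (k : ℕ) (i : Fin 3) :
    gasketShift (k + 1) i = gasketShift k i + gasketShift k i := by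
  fin_cases i <;> simp [gasketShift, pow_succ, mul_two]

theorem exists_eq_gasketShift_zero_iff {z : ℤ × ℤ} :
    (∃ i, z = gasketShift 0 i) ↔ z ∈ gasketTriangle 0 := by
  simp [gasketShift, gasketTriangle, Fin.exists_fin_succ, Prod.mk_zero_zero]

theorem mem_gasketLevelCells_succ_iff_exists_shift {k : ℕ} {c : ℤ × ℤ} :
    c ∈ gasketLevelCells (k + 1) ↔ ∃ i, c - gasketShift k i ∈ gasketLevelCells k := by
  induction k generalizing c with
  | zero =>
    simp only [mem_gasketLevelCells_succ_iff, gasketLevelCells_zero, Set.mem_singleton_iff,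
      exists_eq_left, zero_add, exists_eq_right', sub_eq_zero, exists_eq_gasketShift_zero_iff]
  | succ k ih =>
    rw [mem_gasketLevelCells_succ_iff]
    constructor
    · rintro ⟨d, hd, p, hp, rfl⟩
      obtain ⟨i, hi⟩ := ih.1 hd
      refine ⟨i, mem_gasketLevelCells_succ_iff.2
        ⟨_, hi, p - gasketShift k i, sub_mem_gasketTriangle_sub.2 hp, ?_⟩⟩
      rw [gasketShift_succ, add_sub_add_comm]
    · rintro ⟨i, hi⟩
      obtain ⟨d, hd, p, hp, hdp⟩ := mem_gasketLevelCells_succ_iff.1 hi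
      refine ⟨d + gasketShift k i, ih.2 ⟨i, by rwa [add_sub_cancel_right]⟩, p + gasketShift k i,
        add_right_mem_gasketTriangle_add_right.2 hp, ?_⟩
      rw [add_add_add_comm, ← hdp, ← gasketShift_succ, sub_add_cancel]

theorem mem_gasketLevelVertices_iff {k : ℕ} {z : ℤ × ℤ} :
    z ∈ gasketLevelVertices k ↔ ∃ c ∈ gasketLevelCells k, z ∈ gasketTriangle c := by
  induction k generalizing z with
  | zero => simp [gasketLevelVertices, gasketLevelCells_zero, gasketTriangle, Prod.mk_zero_zero]
  | succ k ih =>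
    simp only [gasketLevelVertices, Set.mem_iUnion, Set.mem_image, ih,
      mem_gasketLevelCells_succ_iff_exists_shift]
    constructor
    · rintro ⟨i, w, ⟨c, hc, hw⟩, rfl⟩
      exact ⟨c + gasketShift k i, ⟨i, by rwa [add_sub_cancel_right]⟩,
        add_right_mem_gasketTriangle_add_right.2 hw⟩
    · rintro ⟨c, ⟨i, hc⟩, hz⟩
      exact ⟨i, z - gasketShift k i, ⟨_, hc, sub_mem_gasketTriangle_sub.2 hz⟩, sub_add_cancel _ _⟩

theorem gasketLevel_adj_iff {k : ℕ} {u v : ℤ × ℤ} : (gasketLevel k).Adj u v ↔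
    ∃ c ∈ gasketLevelCells k, u ∈ gasketTriangle c ∧ v ∈ gasketTriangle c ∧ u ≠ v := by
  induction k generalizing u v with
  | zero =>
    change (u ∈ gasketLevelVertices 0 ∧ v ∈ gasketLevelVertices 0 ∧ u ≠ v) ↔ _
    simp [mem_gasketLevelVertices_iff, gasketLevelCells_zero]
  | succ k ih =>
    simp only [gasketLevel, SimpleGraph.iSup_adj, SimpleGraph.map_adj, ih,
      mem_gasketLevelCells_succ_iff_exists_shift]
    constructor
    · rintro ⟨i, u, v, ⟨c, hc, hu, hv, hne⟩, rfl, rfl⟩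
      exact ⟨c + gasketShift k i, ⟨i, by rwa [add_sub_cancel_right]⟩,
        add_right_mem_gasketTriangle_add_right.2 hu, add_right_mem_gasketTriangle_add_right.2 hv,
        add_left_injective _ |>.ne hne⟩
    · rintro ⟨c, ⟨i, hc⟩, hu, hv, hne⟩
      exact ⟨i, u - gasketShift k i, v - gasketShift k i,
        ⟨_, hc, sub_mem_gasketTriangle_sub.2 hu, sub_mem_gasketTriangle_sub.2 hv, by simpa⟩,
        sub_add_cancel _ _, sub_add_cancel _ _⟩

theorem exists_mem_gasketLevelCells_iff {c : ℤ × ℤ} :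
    (∃ k, c ∈ gasketLevelCells k) ↔ GasketCell c := by
  refine ⟨fun ⟨_, hc⟩ => hc.1, fun hc => ?_⟩
  obtain ⟨k, hk⟩ := pow_unbounded_of_one_lt (c.1 + c.2) (one_lt_two : (1 : ℤ) < 2)
  exact ⟨k, hc, hk⟩

theorem mem_gasketPlus_iff {z : ℤ × ℤ} :
    z ∈ gasketPlus ↔ ∃ c, GasketCell c ∧ z ∈ gasketTriangle c := by
  simp only [gasketPlus, Set.mem_iUnion, mem_gasketLevelVertices_iff,
    ← exists_mem_gasketLevelCells_iff]
  grind

theorem exists_gasketLevel_adj_iff {u v : ℤ × ℤ} : (∃ k, (gasketLevel k).Adj u v) ↔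
    ∃ c, GasketCell c ∧ u ∈ gasketTriangle c ∧ v ∈ gasketTriangle c ∧ u ≠ v := by
  simp only [gasketLevel_adj_iff, ← exists_mem_gasketLevelCells_iff]
  grind

section CellsAt

variable {c p q z : ℤ × ℤ}

open Classical in
/-- The (lower left corners of the) triangles of `SG⁺` that contain the vertex `z`. -/
noncomputable def gasketCellsAt (z : ℤ × ℤ) : Finset (ℤ × ℤ) :=
  {c ∈ {z, z - (1, 0), z - (0, 1)} | GasketCell c}

theorem mem_gasketCellsAt : c ∈ gasketCellsAt z ↔ GasketCell c ∧ z ∈ gasketTriangle c := by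
  simp only [gasketCellsAt, Finset.mem_filter, Finset.mem_insert, Finset.mem_singleton,
    gasketTriangle, eq_sub_iff_add_eq]
  grind

theorem gasketCellsAt_nonempty_iff : (gasketCellsAt z).Nonempty ↔ z ∈ gasketPlus := by
  simp only [Finset.Nonempty, mem_gasketCellsAt, mem_gasketPlus_iff]

theorem nonneg_of_mem_gasketPlus (hz : z ∈ gasketPlus) : 0 ≤ z.1 ∧ 0 ≤ z.2 := by
  obtain ⟨c, hc, hcz⟩ := mem_gasketPlus_iff.1 hz
  have := hc.nonneg
  rw [mem_gasketTriangle] at hcz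
  omega

theorem GasketCell.mem_gasketPlus (hc : GasketCell c) (hp : p ∈ gasketTriangle c) :
    p ∈ gasketPlus :=
  mem_gasketPlus_iff.2 ⟨c, hc, hp⟩

theorem GasketCell.add_mem_gasketPlus (hc : GasketCell c) (hp : p ∈ gasketTriangle c)
    (hq : q ∈ gasketTriangle c) : p + q ∈ gasketPlus :=
  (hc.add hp).mem_gasketPlus (add_mem_gasketTriangle_add.2 hq)

theorem add_self_mem_gasketPlus (hp : p ∈ gasketPlus) : p + p ∈ gasketPlus := by
  obtain ⟨c, hc, hp⟩ := mem_gasketPlus_iff.1 hp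
  exact hc.add_mem_gasketPlus hp hp

theorem exists_cell_eq_add (hz : z ∈ gasketPlus) :
    ∃ c, GasketCell c ∧ ∃ p ∈ gasketTriangle c, ∃ q ∈ gasketTriangle c, z = p + q := by
  obtain ⟨_, hd, hz⟩ := mem_gasketPlus_iff.1 hz
  obtain ⟨c, hc, p, hp, rfl⟩ := hd.exists_eq_add
  refine ⟨c, hc, p, hp, z - p, ?_, (add_sub_cancel p z).symm⟩
  rwa [← add_mem_gasketTriangle_add (p := p), add_sub_cancel]

theorem gasketCellsAt_add_self (p : ℤ × ℤ) :
    gasketCellsAt (p + p) = (gasketCellsAt p).map (addRightEmbedding p) := by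
  ext d
  simp only [mem_gasketCellsAt, Finset.mem_map, addRightEmbedding_apply]
  constructor
  · rintro ⟨hd, hpd⟩
    obtain ⟨c, hc, q, hq, rfl⟩ := hd.exists_eq_add
    obtain rfl : p = q := by
      rw [mem_gasketTriangle] at hq hpd
      simp only [Prod.fst_add, Prod.snd_add] at hpd
      ext <;> omega
    exact ⟨c, ⟨hc, hq⟩, rfl⟩
  · rintro ⟨c, ⟨hc, hp⟩, rfl⟩
    exact ⟨hc.add hp, add_mem_gasketTriangle_add.2 hp⟩

theorem gasketCellsAt_midpoint (hc : GasketCell c) (hp : p ∈ gasketTriangle c)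
    (hq : q ∈ gasketTriangle c) (hpq : p ≠ q) : gasketCellsAt (p + q) = {c + p, c + q} := by
  ext d
  simp only [mem_gasketCellsAt, Finset.mem_insert, Finset.mem_singleton]
  constructor
  · rintro ⟨hd, hpqd⟩
    obtain ⟨e, he, r, hr, rfl⟩ := hd.exists_eq_add
    have key : e = c ∧ (r = p ∨ r = q) := by
      rw [mem_gasketTriangle] at hp hq hr hpqd
      simp only [Prod.fst_add, Prod.snd_add] at hpqd
      rw [ne_eq, Prod.ext_iff] at hpq
      simp only [Prod.ext_iff]
      omega
    obtain ⟨rfl, rfl | rfl⟩ := key <;> simp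
  · rintro (rfl | rfl)
    · exact ⟨hc.add hp, add_mem_gasketTriangle_add.2 hq⟩
    · exact ⟨hc.add hq, add_comm q p ▸ add_mem_gasketTriangle_add.2 hp⟩

/-- The graph distance of `z` to the origin, for `z` in `SG`; see `mem_gasketBall_iff`. -/
def gasketNorm (z : ℤ × ℤ) : ℕ := z.1.natAbs + z.2.natAbs

theorem gasketNorm_add_self (p : ℤ × ℤ) : gasketNorm (p + p) = 2 * gasketNorm p := by
  simp only [gasketNorm, Prod.fst_add, Prod.snd_add]
  omega

theorem gasketNorm_pos_iff : 0 < gasketNorm p ↔ p ≠ 0 := by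
  rw [ne_eq, Prod.ext_iff, Prod.fst_zero, Prod.snd_zero, gasketNorm]
  omega

theorem gasketNorm_neg (p : ℤ × ℤ) : gasketNorm (-p) = gasketNorm p := by
  simp [gasketNorm]

@[elab_as_elim]
theorem gasketPlus_induction {motive : ∀ z, z ∈ gasketPlus → Prop}
    (zero : motive 0 (GasketCell.zero.mem_gasketPlus (self_mem_gasketTriangle 0)))
    (double : ∀ p (hp : p ∈ gasketPlus), p ≠ 0 → motive p hp →
      motive (p + p) (add_self_mem_gasketPlus hp))
    (midpoint : ∀ c (hc : GasketCell c) p (hp : p ∈ gasketTriangle c) q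
      (hq : q ∈ gasketTriangle c), p ≠ q →
      (∀ r (hr : r ∈ gasketTriangle c), gasketNorm r < gasketNorm (p + q) →
        motive r (hc.mem_gasketPlus hr)) →
      motive (p + q) (hc.add_mem_gasketPlus hp hq))
    (z : ℤ × ℤ) (hz : z ∈ gasketPlus) : motive z hz := by
  induction hn : gasketNorm z using Nat.strong_induction_on generalizing z with
  | _ n ih =>
    subst hn
    obtain ⟨c, hc, p, hp, q, hq, rfl⟩ := exists_cell_eq_add hz
    obtain rfl | hpq := eq_or_ne p q
    · obtain rfl | h0 := eq_or_ne p 0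
      · exact zero
      have hlt : gasketNorm p < gasketNorm (p + p) := by
        have := gasketNorm_pos_iff.2 h0
        rw [gasketNorm_add_self]
        omega
      exact double p (hc.mem_gasketPlus hp) h0 (ih _ hlt _ _ rfl)
    · exact midpoint c hc p hp q hq hpq fun r hr hlt => ih _ hlt _ _ rfl

theorem card_gasketCellsAt (hz : z ∈ gasketPlus) (h0 : z ≠ 0) : (gasketCellsAt z).card = 2 := by
  induction z, hz using gasketPlus_induction with
  | zero => exact absurd rfl h0
  | double p _ hp0 ih => rw [gasketCellsAt_add_self, Finset.card_map, ih hp0]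
  | midpoint c hc p hp q hq hpq _ =>
    rw [gasketCellsAt_midpoint hc hp hq hpq, Finset.card_pair (by simpa)]

theorem gasketCellsAt_zero : gasketCellsAt 0 = {0} := by
  ext c
  rw [mem_gasketCellsAt, Finset.mem_singleton]
  constructor
  · rintro ⟨hc, h0⟩
    have := hc.nonneg
    simp only [mem_gasketTriangle, Prod.fst_zero, Prod.snd_zero] at h0
    ext <;> simp only [Prod.fst_zero, Prod.snd_zero] <;> omega
  · rintro rfl
    exact ⟨.zero, self_mem_gasketTriangle 0⟩

theorem gasketCellsAt_neg_eq_empty (hz : z ∈ gasketPlus) (h0 : z ≠ 0) :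
    gasketCellsAt (-z) = ∅ := by
  rw [← Finset.not_nonempty_iff_eq_empty, gasketCellsAt_nonempty_iff]
  intro hneg
  have h1 := nonneg_of_mem_gasketPlus hz
  have h2 := nonneg_of_mem_gasketPlus hneg
  simp only [Prod.fst_neg, Prod.snd_neg] at h2
  exact h0 (Prod.ext (by simp only [Prod.fst_zero]; omega) (by simp only [Prod.snd_zero]; omega))

/-- Off the origin only one of the two summands is nonzero; at the origin each of them is `1`. -/
theorem card_gasketCellsAt_add_card_neg (z : Gasket) :
    (gasketCellsAt z).card + (gasketCellsAt (-z)).card = 2 := by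
  obtain h0 | h0 := eq_or_ne (z : ℤ × ℤ) 0
  · simp [h0, gasketCellsAt_zero]
  · rcases z.2 with hz | hz
    · rw [card_gasketCellsAt hz h0, gasketCellsAt_neg_eq_empty hz h0, Finset.card_empty]
    · have hempty := gasketCellsAt_neg_eq_empty hz (neg_ne_zero.2 h0)
      rw [neg_neg] at hempty
      rw [card_gasketCellsAt hz (neg_ne_zero.2 h0), hempty, Finset.card_empty]

end CellsAt

/-! ### The Laplacian as a sum over triangles -/

section Laplacian

variable {z : ℤ × ℤ}

/-- The neighbours of `z` that share a triangle of `SG⁺` with `z`. -/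
noncomputable def gasketPlusNeighbors (z : ℤ × ℤ) : Finset (ℤ × ℤ) :=
  (gasketCellsAt z).biUnion fun c => (gasketTriangle c).erase z

theorem exists_gasketLevel_adj_iff_mem_gasketPlusNeighbors {u v : ℤ × ℤ} :
    (∃ k, (gasketLevel k).Adj u v) ↔ v ∈ gasketPlusNeighbors u := by
  simp only [exists_gasketLevel_adj_iff, gasketPlusNeighbors, Finset.mem_biUnion,
    mem_gasketCellsAt, Finset.mem_erase]
  grind

theorem sum_gasketPlusNeighbors (f : ℤ × ℤ → ℝ) (z : ℤ × ℤ) :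
    ∑ y ∈ gasketPlusNeighbors z, f y =
      ∑ c ∈ gasketCellsAt z, (∑ q ∈ gasketTriangle c, f q - f z) := by
  rw [gasketPlusNeighbors, Finset.sum_biUnion]
  · exact Finset.sum_congr rfl fun c hc =>
      eq_sub_of_add_eq (Finset.sum_erase_add _ _ (mem_gasketCellsAt.1 hc).2)
  · intro c hc d hd hcd
    simp only [Finset.mem_coe, mem_gasketCellsAt, mem_gasketTriangle] at hc hd
    rw [Function.onFun, Finset.disjoint_left]
    intro y hyc hyd
    rw [Finset.mem_erase, mem_gasketTriangle, ne_eq, Prod.ext_iff] at hyc hyd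
    rw [ne_eq, Prod.ext_iff] at hcd
    omega

theorem gasketGraph_adj_iff {u v : Gasket} : gasketGraph.Adj u v ↔
    (v : ℤ × ℤ) ∈ gasketPlusNeighbors u ∨ -(v : ℤ × ℤ) ∈ gasketPlusNeighbors (-u) := by
  simp only [← exists_gasketLevel_adj_iff_mem_gasketPlusNeighbors]
  rfl

theorem mem_gasketPlus_of_mem_gasketPlusNeighbors {y : ℤ × ℤ} (hy : y ∈ gasketPlusNeighbors z) :
    y ∈ gasketPlus ∧ z ∈ gasketPlus ∧ y ≠ z := by
  simp only [gasketPlusNeighbors, Finset.mem_biUnion, mem_gasketCellsAt, Finset.mem_erase] at hy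
  obtain ⟨c, ⟨hc, hz⟩, hne, hy⟩ := hy
  exact ⟨hc.mem_gasketPlus hy, hc.mem_gasketPlus hz, hne⟩

theorem disjoint_gasketPlusNeighbors_neg (z : ℤ × ℤ) :
    Disjoint (gasketPlusNeighbors z)
      ((gasketPlusNeighbors (-z)).map (Equiv.neg _).toEmbedding) := by
  rw [Finset.disjoint_left]
  intro y hy hy'
  obtain ⟨x, hx, rfl⟩ := Finset.mem_map.1 hy'
  obtain ⟨hy, hz, hne⟩ := mem_gasketPlus_of_mem_gasketPlusNeighbors hy
  obtain ⟨hx, hz', -⟩ := mem_gasketPlus_of_mem_gasketPlusNeighbors hx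
  replace hx := nonneg_of_mem_gasketPlus hx
  replace hy := nonneg_of_mem_gasketPlus hy
  replace hz := nonneg_of_mem_gasketPlus hz
  replace hz' := nonneg_of_mem_gasketPlus hz'
  simp only [Equiv.coe_toEmbedding, Equiv.neg_apply, Prod.fst_neg, Prod.snd_neg, ne_eq,
    Prod.ext_iff] at hy hz' hne
  omega

theorem map_neighborFinset (z : Gasket) :
    (gasketGraph.neighborFinset z).map (Function.Embedding.subtype _) =
      (gasketPlusNeighbors z).disjUnion _ (disjoint_gasketPlusNeighbors_neg z) := by
  ext y
  simp only [Finset.mem_map, SimpleGraph.mem_neighborFinset, gasketGraph_adj_iff,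
    Finset.mem_disjUnion, Function.Embedding.subtype_apply, Equiv.coe_toEmbedding,
    Equiv.neg_apply]
  constructor
  · rintro ⟨v, hv | hv, rfl⟩
    · exact .inl hv
    · exact .inr ⟨_, hv, neg_neg _⟩
  · rintro (hy | ⟨x, hx, rfl⟩)
    · exact ⟨⟨y, .inl (mem_gasketPlus_of_mem_gasketPlusNeighbors hy).1⟩, .inl hy, rfl⟩
    · refine ⟨⟨-x, .inr ?_⟩, .inr ?_, rfl⟩
      · simpa using (mem_gasketPlus_of_mem_gasketPlusNeighbors hx).1
      · simpa using hx

theorem sum_neighborFinset (f : ℤ × ℤ → ℝ) (z : Gasket) :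
    ∑ y ∈ gasketGraph.neighborFinset z, f y =
      ∑ y ∈ gasketPlusNeighbors z, f y + ∑ y ∈ gasketPlusNeighbors (-z), f (-y) := by
  calc ∑ y ∈ gasketGraph.neighborFinset z, f y
      = ∑ y ∈ (gasketGraph.neighborFinset z).map (Function.Embedding.subtype _), f y :=
        (Finset.sum_map _ (Function.Embedding.subtype _) f).symm
    _ = _ := by
        rw [map_neighborFinset, Finset.sum_disjUnion, Finset.sum_map]
        rfl

/-- Four times the part of the graph Laplacian of `f` at `z` that comes from the triangles of `SG⁺`
around `z`. -/
noncomputable def cellLaplacian (f : ℤ × ℤ → ℝ) (z : ℤ × ℤ) : ℝ :=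
  ∑ c ∈ gasketCellsAt z, (∑ q ∈ gasketTriangle c, f q - 3 * f z)

theorem cellLaplacian_eq (f : ℤ × ℤ → ℝ) (z : ℤ × ℤ) :
    cellLaplacian f z =
      ∑ y ∈ gasketPlusNeighbors z, f y - 2 * (gasketCellsAt z).card * f z := by
  rw [sum_gasketPlusNeighbors, cellLaplacian, Finset.sum_sub_distrib, Finset.sum_sub_distrib,
    Finset.sum_const, Finset.sum_const, nsmul_eq_mul, nsmul_eq_mul]
  ring

theorem four_mul_gasketLaplacian (f : ℤ × ℤ → ℝ) (z : Gasket) :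
    4 * gasketLaplacian (fun w => f w) z =
      cellLaplacian f z + cellLaplacian (fun w => f (-w)) (-z) := by
  have hcard : ((gasketCellsAt z).card + (gasketCellsAt (-z)).card : ℝ) = 2 := by
    exact_mod_cast card_gasketCellsAt_add_card_neg z
  rw [gasketLaplacian, sum_neighborFinset, cellLaplacian_eq, cellLaplacian_eq, neg_neg]
  linear_combination 2 * f z * hcard

theorem four_mul_gasketLaplacian_of_mem_gasketPlus (f : ℤ × ℤ → ℝ) {z : Gasket}
    (hz : (z : ℤ × ℤ) ∈ gasketPlus) (h0 : (z : ℤ × ℤ) ≠ 0) :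
    4 * gasketLaplacian (fun w => f w) z = cellLaplacian f z := by
  rw [four_mul_gasketLaplacian, add_eq_left, cellLaplacian, gasketCellsAt_neg_eq_empty hz h0,
    Finset.sum_empty]

theorem cellLaplacian_const (a : ℝ) (z : ℤ × ℤ) : cellLaplacian (fun _ => a) z = 0 := by
  refine Finset.sum_eq_zero fun c _ => ?_
  rw [Finset.sum_const, card_gasketTriangle, nsmul_eq_mul, Nat.cast_ofNat, sub_self]

theorem gasketGraph_degree (z : Gasket) : gasketGraph.degree z = 4 := by
  have h := four_mul_gasketLaplacian (fun _ => 1) z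
  rw [cellLaplacian_const, cellLaplacian_const, gasketLaplacian, Finset.sum_const,
    SimpleGraph.card_neighborFinset_eq_degree, nsmul_one] at h
  have : (gasketGraph.degree z : ℝ) = 4 := by linarith
  exact_mod_cast this

theorem cellLaplacian_congr {f g : ℤ × ℤ → ℝ}
    (h : ∀ c ∈ gasketCellsAt z, ∀ q ∈ gasketTriangle c, f q = g q) :
    cellLaplacian f z = cellLaplacian g z := by
  refine Finset.sum_congr rfl fun c hc => ?_
  rw [Finset.sum_congr rfl (h c hc), h c hc z (mem_gasketCellsAt.1 hc).2]

end Laplacian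

/-! ### Balls -/

section Ball

theorem gasketNorm_le_add_one_of_mem_gasketPlusNeighbors {u v : ℤ × ℤ}
    (h : v ∈ gasketPlusNeighbors u) : gasketNorm v ≤ gasketNorm u + 1 := by
  simp only [gasketPlusNeighbors, Finset.mem_biUnion, mem_gasketCellsAt, Finset.mem_erase] at h
  obtain ⟨c, ⟨hc, hu⟩, -, hv⟩ := h
  have := hc.nonneg
  rw [mem_gasketTriangle] at hu hv
  simp only [gasketNorm]
  omega

theorem gasketNorm_le_add_one_of_adj {u v : Gasket} (h : gasketGraph.Adj u v) :
    gasketNorm v ≤ gasketNorm u + 1 := by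
  rcases gasketGraph_adj_iff.1 h with h | h
  · exact gasketNorm_le_add_one_of_mem_gasketPlusNeighbors h
  · simpa only [gasketNorm_neg] using gasketNorm_le_add_one_of_mem_gasketPlusNeighbors h

theorem exists_mem_gasketPlusNeighbors_gasketNorm_add_one {z : ℤ × ℤ} (hz : z ∈ gasketPlus)
    (h0 : z ≠ 0) : ∃ w ∈ gasketPlusNeighbors z, gasketNorm w + 1 = gasketNorm z := by
  obtain ⟨c, hc, hcz⟩ :=
    Finset.exists_mem_ne (one_lt_two.trans_eq (card_gasketCellsAt hz h0).symm) z
  refine ⟨c, Finset.mem_biUnion.2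
    ⟨c, hc, Finset.mem_erase.2 ⟨hcz, self_mem_gasketTriangle c⟩⟩, ?_⟩
  rw [mem_gasketCellsAt, mem_gasketTriangle] at hc
  have := hc.1.nonneg
  rw [ne_eq, Prod.ext_iff] at hcz
  simp only [gasketNorm]
  omega

theorem exists_adj_gasketNorm_add_one {z : Gasket} (h0 : (z : ℤ × ℤ) ≠ 0) :
    ∃ w : Gasket, gasketGraph.Adj w z ∧ gasketNorm w + 1 = gasketNorm z := by
  simp only [gasketGraph.adj_comm _ z, gasketGraph_adj_iff]
  rcases z.2 with hz | hz
  · obtain ⟨w, hw, hnorm⟩ := exists_mem_gasketPlusNeighbors_gasketNorm_add_one hz h0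
    exact ⟨⟨w, .inl (mem_gasketPlus_of_mem_gasketPlusNeighbors hw).1⟩, .inl hw, hnorm⟩
  · obtain ⟨w, hw, hnorm⟩ :=
      exists_mem_gasketPlusNeighbors_gasketNorm_add_one hz (neg_ne_zero.2 h0)
    refine ⟨⟨-w, .inr ?_⟩, .inr (by rwa [neg_neg]), by simpa only [gasketNorm_neg] using hnorm⟩
    simpa using (mem_gasketPlus_of_mem_gasketPlusNeighbors hw).1

theorem gasketNorm_le_add_length {u v : Gasket} (p : gasketGraph.Walk u v) :
    gasketNorm v ≤ gasketNorm u + p.length := by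
  induction p with
  | nil => simp
  | cons h p ih =>
    have := gasketNorm_le_add_one_of_adj h
    rw [SimpleGraph.Walk.length_cons]
    omega

theorem exists_walk_length_eq_gasketNorm (z : Gasket) :
    ∃ p : gasketGraph.Walk gasketOrigin z, p.length = gasketNorm z := by
  induction hn : gasketNorm z generalizing z with
  | zero =>
    obtain rfl : z = gasketOrigin := Subtype.ext <| by
      by_contra h0
      exact (gasketNorm_pos_iff.2 h0).ne' hn
    exact ⟨.nil, rfl⟩
  | succ n ih =>
    obtain ⟨w, hadj, hnorm⟩ := exists_adj_gasketNorm_add_one (z := z)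
      (gasketNorm_pos_iff.1 (by omega))
    obtain ⟨p, hp⟩ := ih w (by omega)
    exact ⟨p.concat hadj, by rw [SimpleGraph.Walk.length_concat, hp]⟩

theorem gasketGraph_preconnected : gasketGraph.Preconnected := fun u v =>
  let ⟨p, _⟩ := exists_walk_length_eq_gasketNorm u
  let ⟨q, _⟩ := exists_walk_length_eq_gasketNorm v
  ⟨p.reverse.append q⟩

theorem edist_gasketOrigin (z : Gasket) : gasketGraph.edist gasketOrigin z = gasketNorm z := by
  obtain ⟨p, hp⟩ := exists_walk_length_eq_gasketNorm z
  refine le_antisymm (hp ▸ p.edist_le) (le_iInf fun q => ?_)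
  have h0 : gasketNorm gasketOrigin = 0 := rfl
  exact_mod_cast (gasketNorm_le_add_length q).trans_eq (by rw [h0, zero_add])

theorem mem_gasketBall_iff {n : ℕ} {z : Gasket} : z ∈ gasketBall n ↔ gasketNorm z ≤ n := by
  rw [gasketBall, Set.mem_ofPred_eq, edist_gasketOrigin, Nat.cast_le]

theorem gasketBall_finite (n : ℕ) : (gasketBall n).Finite := by
  refine Set.Finite.of_finite_image (f := Subtype.val) ?_ Subtype.val_injective.injOn
  refine (Set.finite_Icc ((-n, -n) : ℤ × ℤ) (n, n)).subset ?_
  rintro _ ⟨z, hz, rfl⟩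
  rw [mem_gasketBall_iff, gasketNorm] at hz
  constructor <;> constructor <;> dsimp only <;> omega

instance Gasket.infinite : Infinite Gasket :=
  Infinite.of_injective
    (fun n : ℕ => ⟨((n : ℤ), 0), .inl ((GasketCell.natCast_zero n).mem_gasketPlus
      (self_mem_gasketTriangle _))⟩)
    fun m n h => by simpa using congrArg (fun z : Gasket => (z : ℤ × ℤ).1) h

end Ball

/-! ### A maximum principle -/

section MaximumPrinciple

variable {V : Type*} {G : SimpleGraph V} [G.LocallyFinite] {w : V → ℝ} {D : Set V}

theorem eq_of_adj_of_degree_mul_le_sum {x y : V} (hmax : ∀ v, w v ≤ w x)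
    (hsub : G.degree x * w x ≤ ∑ v ∈ G.neighborFinset x, w v) (hxy : G.Adj x y) : w y = w x := by
  have hsum : ∑ v ∈ G.neighborFinset x, w v = ∑ _v ∈ G.neighborFinset x, w x := by
    refine (Finset.sum_le_sum fun v _ => hmax v).antisymm ?_
    rwa [Finset.sum_const, nsmul_eq_mul, G.card_neighborFinset_eq_degree]
  exact (Finset.sum_eq_sum_iff_of_le fun v _ => hmax v).1 hsum y (G.mem_neighborFinset x y |>.2 hxy)

/-- A positive maximum would be attained in `D`, and then propagate along edges to all of `V`. -/
theorem nonpos_of_subharmonicOn (hG : G.Preconnected) (hD : D.Finite) (hD' : D ≠ Set.univ)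
    (hsub : ∀ x ∈ D, G.degree x * w x ≤ ∑ v ∈ G.neighborFinset x, w v)
    (hout : ∀ x ∉ D, w x ≤ 0) (x : V) : w x ≤ 0 := by
  by_contra! hx
  have mem_of_pos : ∀ {v}, 0 < w v → v ∈ D := fun hv => by_contra fun h => (hout _ h).not_gt hv
  obtain ⟨m, -, hm⟩ := D.exists_max_image w hD ⟨x, mem_of_pos hx⟩
  have hpos : 0 < w m := hx.trans_le (hm x (mem_of_pos hx))
  have hmax : ∀ v, w v ≤ w m := fun v =>
    (le_or_gt (w v) 0).elim (·.trans hpos.le) fun hv => hm v (mem_of_pos hv)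
  have propagate : ∀ {v}, G.Walk m v → w v = w m := by
    intro v p
    induction p using SimpleGraph.Walk.concatRec with
    | Hnil => rfl
    | Hconcat _ hadj ih =>
      have hv := ih hm hpos hmax
      rw [← hv] at hpos hmax ⊢
      exact eq_of_adj_of_degree_mul_le_sum hmax (hsub _ (mem_of_pos hpos)) hadj
  obtain ⟨y, hy⟩ := (Set.ne_univ_iff_exists_notMem D).1 hD'
  obtain ⟨p⟩ := hG m y
  exact hy (mem_of_pos (propagate p ▸ hpos))

end MaximumPrinciple

/-! ### The divisible sandpile -/

section Sandpile

variable {x : ℕ → Gasket} {μ₀ u v : Gasket → ℝ}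

theorem gasketLaplacian_add_smul (f g : Gasket → ℝ) (a : ℝ) :
    gasketLaplacian (f + a • g) = gasketLaplacian f + a • gasketLaplacian g := by
  ext z
  simp only [gasketLaplacian, Pi.add_apply, Pi.smul_apply, smul_eq_mul, Finset.sum_add_distrib,
    ← Finset.mul_sum]
  ring

theorem gasketLaplacian_gasketDelta_self (z : Gasket) : gasketLaplacian (gasketDelta z) z = -1 := by
  have hzero : ∑ y ∈ gasketGraph.neighborFinset z, gasketDelta z y = 0 :=
    Finset.sum_eq_zero fun y hy =>
      Pi.single_eq_of_ne ((gasketGraph.mem_neighborFinset z y).1 hy).ne' _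
  rw [gasketLaplacian, hzero, mul_zero, zero_sub, gasketDelta, Pi.single_eq_same]

theorem tendsto_gasketLaplacian {f : ℕ → Gasket → ℝ} {g : Gasket → ℝ}
    (h : ∀ z, Tendsto (fun n => f n z) atTop (𝓝 (g z))) (z : Gasket) :
    Tendsto (fun n => gasketLaplacian (f n) z) atTop (𝓝 (gasketLaplacian g z)) :=
  ((tendsto_finsetSum _ fun y _ => h y).const_mul _).sub (h z)

theorem sandAfter_sub_sandAfter_succ_self (x : ℕ → Gasket) (μ₀ : Gasket → ℝ) (n : ℕ) :
    sandAfter x μ₀ n (x n) - sandAfter x μ₀ (n + 1) (x n) =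
      max (sandAfter x μ₀ n (x n) - 1) 0 := by
  simp only [sandAfter, topple, Pi.add_apply, Pi.smul_apply, smul_eq_mul,
    gasketLaplacian_gasketDelta_self]
  ring

theorem odometerAfter_succ (x : ℕ → Gasket) (μ₀ : Gasket → ℝ) (n : ℕ) :
    odometerAfter x μ₀ (n + 1) =
      odometerAfter x μ₀ n + max (sandAfter x μ₀ n (x n) - 1) 0 • gasketDelta (x n) := by
  ext y
  simp only [odometerAfter, Finset.range_add_one, Finset.filter_insert, Pi.add_apply,
    Pi.smul_apply, smul_eq_mul]
  split_ifs with h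
  · subst h
    rw [Finset.sum_insert (by simp), sandAfter_sub_sandAfter_succ_self, gasketDelta,
      Pi.single_eq_same, mul_one, add_comm]
  · simp [gasketDelta, Ne.symm h]

theorem odometerAfter_succ_self (x : ℕ → Gasket) (μ₀ : Gasket → ℝ) (n : ℕ) :
    odometerAfter x μ₀ (n + 1) (x n) =
      odometerAfter x μ₀ n (x n) + max (sandAfter x μ₀ n (x n) - 1) 0 := by
  rw [odometerAfter_succ, Pi.add_apply, Pi.smul_apply, gasketDelta, Pi.single_eq_same, smul_eq_mul,
    mul_one]

theorem sandAfter_eq (x : ℕ → Gasket) (μ₀ : Gasket → ℝ) (n : ℕ) :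
    sandAfter x μ₀ n = μ₀ + gasketLaplacian (odometerAfter x μ₀ n) := by
  induction n with
  | zero =>
    ext z
    simp [sandAfter, odometerAfter, gasketLaplacian]
  | succ n ih =>
    rw [odometerAfter_succ, gasketLaplacian_add_smul, ← add_assoc, ← ih]
    rfl

theorem odometerAfter_monotone (x : ℕ → Gasket) (μ₀ : Gasket → ℝ) :
    Monotone (odometerAfter x μ₀) := by
  refine monotone_nat_of_le_succ fun n => ?_
  rw [odometerAfter_succ]
  exact le_add_of_nonneg_right
    (smul_nonneg (le_max_right _ _) (Pi.single_nonneg.2 zero_le_one))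

theorem odometerAfter_le (hu : 0 ≤ u) (hstab : ∀ z, μ₀ z + gasketLaplacian u z ≤ 1)
    (x : ℕ → Gasket) (n : ℕ) : odometerAfter x μ₀ n ≤ u := by
  induction n with
  | zero => exact fun z => by simpa [odometerAfter] using hu z
  | succ n ih =>
    intro z
    by_cases h : x n = z
    · subst h
      rw [odometerAfter_succ_self, ← max_add_add_left, add_zero]
      refine max_le ?_ (ih _)
      rw [sandAfter_eq]
      have hsum := Finset.sum_le_sum fun w (_ : w ∈ gasketGraph.neighborFinset (x n)) => ih w
      have hxn := hstab (x n)
      simp only [gasketLaplacian, Pi.add_apply] at hxn ⊢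
      linarith
    · simpa [odometerAfter_succ, gasketDelta, Ne.symm h] using ih z

/-- Each time `z` is toppled, its excess mass is at most the increment of the odometer at `z`, which
tends to `0`. -/
theorem add_gasketLaplacian_le_one_of_tendsto (hx : IsTopplingSequence x)
    (hv : ∀ z, Tendsto (fun n => odometerAfter x μ₀ n z) atTop (𝓝 (v z))) (z : Gasket) :
    μ₀ z + gasketLaplacian v z ≤ 1 := by
  have hsand : Tendsto (fun n => sandAfter x μ₀ n z) atTop (𝓝 (μ₀ z + gasketLaplacian v z)) := by
    simp only [sandAfter_eq, Pi.add_apply]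
    exact (tendsto_gasketLaplacian hv z).const_add _
  have hincr : Tendsto (fun n => odometerAfter x μ₀ (n + 1) z - odometerAfter x μ₀ n z + 1) atTop
      (𝓝 1) := by
    simpa using (((tendsto_add_atTop_iff_nat 1).2 (hv z)).sub (hv z)).add_const 1
  refine le_of_tendsto_of_tendsto_of_frequently hsand hincr ?_
  refine (Nat.frequently_atTop_iff_infinite.2 (hx z)).mono ?_
  rintro n rfl
  rw [odometerAfter_succ_self]
  linarith [le_max_left (sandAfter x μ₀ n (x n) - 1) 0]

theorem exists_tendsto_odometerAfter (hu : 0 ≤ u) (hstab : ∀ z, μ₀ z + gasketLaplacian u z ≤ 1)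
    (x : ℕ → Gasket) : ∃ v, 0 ≤ v ∧ v ≤ u ∧
      ∀ z, Tendsto (fun n => odometerAfter x μ₀ n z) atTop (𝓝 (v z)) := by
  have hle := odometerAfter_le hu hstab x
  have hbdd : ∀ z, BddAbove (Set.range fun n => odometerAfter x μ₀ n z) := fun z =>
    ⟨u z, Set.forall_mem_range.2 fun n => hle n z⟩
  refine ⟨fun z => ⨆ n, odometerAfter x μ₀ n z, fun z => ?_, fun z => ciSup_le fun n => hle n z,
    fun z => tendsto_atTop_ciSup (fun _ _ h => odometerAfter_monotone x μ₀ h z) (hbdd z)⟩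
  exact le_ciSup_of_le (hbdd z) 0 (by simp [odometerAfter])

theorem le_of_gasketLaplacian_le (hv : 0 ≤ v) (hfin : (sandpileCluster u).Finite)
    (hlap : ∀ z, 0 < u z → gasketLaplacian v z ≤ gasketLaplacian u z) : u ≤ v := by
  suffices h : ∀ z, (u + (-1 : ℝ) • v) z ≤ 0 from fun z => by
    simpa [← sub_eq_add_neg] using h z
  have hproper : sandpileCluster u ≠ Set.univ := fun h => Set.infinite_univ (h ▸ hfin)
  refine nonpos_of_subharmonicOn gasketGraph_preconnected hfin hproper (fun z hz => ?_)
    fun z hz => ?_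
  · have hsub : 0 ≤ gasketLaplacian (u + (-1 : ℝ) • v) z := by
      rw [gasketLaplacian_add_smul, Pi.add_apply, Pi.smul_apply, smul_eq_mul]
      linarith [hlap z hz]
    rw [gasketGraph_degree, Nat.cast_ofNat]
    rw [gasketLaplacian] at hsub
    linarith
  · have huz : u z ≤ 0 := not_lt.1 hz
    have hvz := hv z
    simp only [Pi.add_apply, Pi.smul_apply, smul_eq_mul, Pi.zero_apply] at hvz ⊢
    linarith

theorem isOdometer_of_stabilizing (hu : 0 ≤ u) (hfin : (sandpileCluster u).Finite)
    (hstab : ∀ z, μ₀ z + gasketLaplacian u z ≤ 1)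
    (hfull : ∀ z, 0 < u z → μ₀ z + gasketLaplacian u z = 1) : IsOdometer μ₀ u := by
  intro x hx
  obtain ⟨v, hv, hvu, htend⟩ := exists_tendsto_odometerAfter hu hstab x
  have huv : u ≤ v := le_of_gasketLaplacian_le hv hfin fun z hz => by
    linarith [hfull z hz, add_gasketLaplacian_le_one_of_tendsto hx htend z]
  exact hvu.antisymm huv ▸ htend

end Sandpile

/-! ### Subdivision and the function `ũ` -/

/-- `f` is obtained from `5 g` by subdivision: on the doubled triangle of a cell `c`, the corners
carry `5 g`, and the midpoints carry the only values that make `Δ f = 1` there. -/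
structure IsRefinement (f g : ℤ × ℤ → ℝ) : Prop where
  double : ∀ p ∈ gasketPlus, f (p + p) = 5 * g p
  midpoint : ∀ c, GasketCell c → ∀ p ∈ gasketTriangle c, ∀ q ∈ gasketTriangle c, p ≠ q →
    f (p + q) = ∑ r ∈ gasketTriangle c, g r + g p + g q - 2

theorem exists_gasketTriangle_eq {c p q : ℤ × ℤ} (hp : p ∈ gasketTriangle c)
    (hq : q ∈ gasketTriangle c) (hpq : p ≠ q) :
    ∃ r ∈ gasketTriangle c, p ≠ r ∧ q ≠ r ∧ gasketTriangle c = {p, q, r} := by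
  have hlt : ({p, q} : Finset (ℤ × ℤ)).card < (gasketTriangle c).card := by
    rw [card_gasketTriangle, Finset.card_pair hpq]
    exact Nat.lt_succ_self 2
  obtain ⟨r, hr, hr'⟩ := Finset.exists_mem_notMem_of_card_lt_card hlt
  simp only [Finset.mem_insert, Finset.mem_singleton, not_or] at hr'
  refine ⟨r, hr, Ne.symm hr'.1, Ne.symm hr'.2, (Finset.eq_of_subset_of_card_le ?_ ?_).symm⟩
  · simp [Finset.insert_subset_iff, hp, hq, hr]
  · rw [card_gasketTriangle,
      Finset.card_eq_three.2 ⟨p, q, r, hpq, Ne.symm hr'.1, Ne.symm hr'.2, rfl⟩]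

theorem sum_triple {α M : Type*} [DecidableEq α] [AddCommMonoid M] {p q r : α} (f : α → M)
    (hpq : p ≠ q) (hpr : p ≠ r) (hqr : q ≠ r) : ∑ s ∈ {p, q, r}, f s = f p + (f q + f r) := by
  rw [Finset.sum_insert (by simp [hpq, hpr]), Finset.sum_pair hqr]

theorem cellLaplacian_midpoint (f : ℤ × ℤ → ℝ) {c p q : ℤ × ℤ} (hc : GasketCell c)
    (hp : p ∈ gasketTriangle c) (hq : q ∈ gasketTriangle c) (hpq : p ≠ q) :
    cellLaplacian f (p + q) =
      ∑ r ∈ gasketTriangle (c + p), f r + ∑ r ∈ gasketTriangle (c + q), f r - 6 * f (p + q) := by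
  rw [cellLaplacian, gasketCellsAt_midpoint hc hp hq hpq, Finset.sum_pair (by simpa)]
  ring

namespace IsRefinement

variable {f g : ℤ × ℤ → ℝ} {c p q : ℤ × ℤ}

theorem sum_gasketTriangle_add (h : IsRefinement f g) (hc : GasketCell c)
    (hp : p ∈ gasketTriangle c) : ∑ r ∈ gasketTriangle (c + p), f r =
      3 * ∑ r ∈ gasketTriangle c, g r + 6 * g p - 4 := by
  have hsum : ∑ q ∈ (gasketTriangle c).erase p, f (p + q) =
      ∑ q ∈ (gasketTriangle c).erase p, (∑ r ∈ gasketTriangle c, g r + g p - 2 + g q) :=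
    Finset.sum_congr rfl fun q hq => by
      rw [Finset.mem_erase] at hq
      rw [h.midpoint c hc p hp q hq.2 hq.1.symm]
      ring
  have hg := Finset.add_sum_erase _ g hp
  rw [_root_.sum_gasketTriangle_add, ← Finset.add_sum_erase _ _ hp,
    h.double p (hc.mem_gasketPlus hp), hsum, Finset.sum_add_distrib, Finset.sum_const,
    Finset.card_erase_of_mem hp, card_gasketTriangle, nsmul_eq_mul]
  push_cast
  linear_combination hg

theorem sum_gasketTriangle_add_sub (h : IsRefinement f g) (hc : GasketCell c)
    (hp : p ∈ gasketTriangle c) : ∑ r ∈ gasketTriangle (c + p), f r - 3 * f (p + p) =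
      3 * (∑ r ∈ gasketTriangle c, g r - 3 * g p) - 4 := by
  rw [h.sum_gasketTriangle_add hc hp, h.double p (hc.mem_gasketPlus hp)]
  ring

theorem cellLaplacian_add_self (h : IsRefinement f g) (hp : p ∈ gasketPlus) (h0 : p ≠ 0) :
    cellLaplacian f (p + p) = 3 * cellLaplacian g p - 8 := by
  have corner : ∀ c ∈ gasketCellsAt p, ∑ r ∈ gasketTriangle (c + p), f r - 3 * f (p + p) =
      3 * (∑ r ∈ gasketTriangle c, g r - 3 * g p) - 4 := fun c hc =>
    h.sum_gasketTriangle_add_sub (mem_gasketCellsAt.1 hc).1 (mem_gasketCellsAt.1 hc).2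
  rw [cellLaplacian, gasketCellsAt_add_self, Finset.sum_map]
  simp only [addRightEmbedding_apply]
  rw [Finset.sum_congr rfl corner, Finset.sum_sub_distrib, ← Finset.mul_sum, Finset.sum_const,
    card_gasketCellsAt hp h0, cellLaplacian, nsmul_eq_mul]
  norm_num

theorem cellLaplacian_midpoint (h : IsRefinement f g) (hc : GasketCell c)
    (hp : p ∈ gasketTriangle c) (hq : q ∈ gasketTriangle c) (hpq : p ≠ q) :
    cellLaplacian f (p + q) = 4 := by
  rw [_root_.cellLaplacian_midpoint f hc hp hq hpq, h.sum_gasketTriangle_add hc hp,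
    h.sum_gasketTriangle_add hc hq, h.midpoint c hc p hp q hq hpq]
  ring

end IsRefinement

/-- The converse of `IsRefinement.cellLaplacian_midpoint`: the three equations `Δ f = 1` at the
midpoints of a triangle form a nonsingular linear system for the values of `f` there. -/
theorem eq_of_cellLaplacian_midpoint {f g : ℤ × ℤ → ℝ} {c p q : ℤ × ℤ} (hc : GasketCell c)
    (hp : p ∈ gasketTriangle c) (hq : q ∈ gasketTriangle c) (hpq : p ≠ q)
    (hdouble : ∀ r ∈ gasketTriangle c, f (r + r) = 5 * g r)
    (hmid : ∀ r ∈ gasketTriangle c, ∀ s ∈ gasketTriangle c, r ≠ s → cellLaplacian f (r + s) = 4) :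
    f (p + q) = ∑ r ∈ gasketTriangle c, g r + g p + g q - 2 := by
  obtain ⟨r, hr, hpr, hqr, htri⟩ := exists_gasketTriangle_eq hp hq hpq
  have e₁ := hmid p hp q hq hpq
  have e₂ := hmid p hp r hr hpr
  have e₃ := hmid q hq r hr hqr
  rw [cellLaplacian_midpoint f hc hp hq hpq] at e₁
  rw [cellLaplacian_midpoint f hc hp hr hpr] at e₂
  rw [cellLaplacian_midpoint f hc hq hr hqr] at e₃
  simp only [sum_gasketTriangle_add, htri, sum_triple _ hpq hpr hqr, hdouble p hp, hdouble q hq,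
    hdouble r hr, add_comm q p, add_comm r p, add_comm r q] at e₁ e₂ e₃ ⊢
  linarith

theorem GasketCell.gasketNorm_corner_lt {c p q r : ℤ × ℤ} (hc : GasketCell c)
    (hp : p ∈ gasketTriangle c) (hq : q ∈ gasketTriangle c) (hpq : p ≠ q) (h2 : 1 < (p + q).2)
    (hr : r ∈ gasketTriangle c) : gasketNorm r < gasketNorm (p + q) := by
  have := hc.nonneg
  rw [ne_eq, Prod.ext_iff] at hpq
  rw [mem_gasketTriangle] at hr hp hq
  simp only [gasketNorm, Prod.fst_add, Prod.snd_add] at h2 ⊢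
  omega

namespace IsUTilde

variable {f g : ℤ × ℤ → ℝ} {c z : ℤ × ℤ}

theorem eq_two_mul_snd (h : IsUTilde f) (hz : z ∈ gasketPlus) (hz2 : z.2 ≤ 1) :
    f z = 2 * z.2 := by
  have hnonneg := nonneg_of_mem_gasketPlus hz
  obtain ⟨x, y⟩ := z
  obtain rfl | rfl : y = 0 ∨ y = 1 := by dsimp only at hz2 hnonneg; omega
  · simp [h.row_zero x hnonneg.1]
  · simp [h.row_one x hnonneg.1 hz]

theorem sum_gasketTriangle_bottom (h : IsUTilde f) (hc : GasketCell c) (hc2 : c.2 = 0) :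
    ∑ q ∈ gasketTriangle c, f q = 2 := by
  have hrow : ∀ q ∈ gasketTriangle c, f q = 2 * q.2 := fun q hq =>
    h.eq_two_mul_snd (hc.mem_gasketPlus hq) (by rw [mem_gasketTriangle] at hq; omega)
  rw [Finset.sum_congr rfl hrow, sum_gasketTriangle]
  simp [hc2]

theorem cellLaplacian_eq (h : IsUTilde f) (hz : z ∈ gasketPlus) (h0 : z ≠ 0) :
    cellLaplacian f z = 4 := by
  have hnonneg := nonneg_of_mem_gasketPlus hz
  obtain hz2 | hz2 := hnonneg.2.eq_or_lt
  · have hbottom : ∀ c ∈ gasketCellsAt z, ∑ q ∈ gasketTriangle c, f q - 3 * f z = 2 := by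
      intro c hcz
      rw [mem_gasketCellsAt, mem_gasketTriangle] at hcz
      have := hcz.1.nonneg
      rw [h.sum_gasketTriangle_bottom hcz.1 (by omega), h.eq_two_mul_snd hz (by omega), ← hz2]
      simp
    rw [cellLaplacian, Finset.sum_congr rfl hbottom, Finset.sum_const, card_gasketCellsAt hz h0]
    norm_num
  · rw [← four_mul_gasketLaplacian_of_mem_gasketPlus f (z := ⟨z, .inl hz⟩) hz h0,
      h.laplacian_eq_one ⟨z, .inl hz⟩ hz hz2, mul_one]

theorem of_cellLaplacian_eq (h0 : ∀ x : ℤ, 0 ≤ x → f (x, 0) = 0)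
    (h1 : ∀ x : ℤ, 0 ≤ x → (x, 1) ∈ gasketPlus → f (x, 1) = 2)
    (hlap : ∀ z ∈ gasketPlus, z ≠ 0 → cellLaplacian f z = 4) : IsUTilde f where
  row_zero := h0
  row_one := h1
  laplacian_eq_one z hz hz2 := by
    have hz0 : (z : ℤ × ℤ) ≠ 0 := by
      intro h
      simp [h] at hz2
    linarith [four_mul_gasketLaplacian_of_mem_gasketPlus f hz hz0, hlap z hz hz0]

theorem isRefinement_half (h : IsUTilde f) : IsRefinement f fun p => f (p + p) / 5 where
  double p _ := by ring
  midpoint c hc p hp q hq hpq := by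
    refine eq_of_cellLaplacian_midpoint hc hp hq hpq (fun r _ => by ring) fun r hr s hs hrs => ?_
    refine h.cellLaplacian_eq (hc.add_mem_gasketPlus hr hs) fun h0 => hrs ?_
    have := hc.nonneg
    rw [mem_gasketTriangle] at hr hs
    simp only [Prod.ext_iff, Prod.fst_add, Prod.snd_add, Prod.fst_zero, Prod.snd_zero] at h0 ⊢
    omega

theorem half (h : IsUTilde f) : IsUTilde fun p => f (p + p) / 5 := by
  refine of_cellLaplacian_eq (fun x hx => ?_) (fun x hx _ => ?_) fun z hz h0 => ?_
  · simp [h.row_zero (x + x) (by omega)]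
  · lift x to ℕ using hx
    have hc := GasketCell.natCast_zero x
    have hup : ((x : ℤ), (1 : ℤ)) ∈ gasketTriangle ((x : ℤ), 0) := by simp [gasketTriangle]
    have hmid := h.isRefinement_half.midpoint _ hc _ (self_mem_gasketTriangle _) _ hup (by simp)
    rw [h.eq_two_mul_snd (hc.add_mem_gasketPlus (self_mem_gasketTriangle _) hup) (by simp),
      sum_gasketTriangle] at hmid
    simp only [Prod.mk_add_mk, add_zero, zero_add, Int.cast_one, mul_one,
      h.row_zero ((x : ℤ) + x) (by omega), h.row_zero ((x : ℤ) + 1 + (x + 1)) (by omega)] at hmid ⊢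
    linarith
  · have hf := h.cellLaplacian_eq (add_self_mem_gasketPlus hz) fun h2 => h0 (by
      simp only [Prod.ext_iff, Prod.fst_add, Prod.snd_add, Prod.fst_zero, Prod.snd_zero] at h2 ⊢
      omega)
    rw [h.isRefinement_half.cellLaplacian_add_self hz h0] at hf
    linarith

theorem eqOn (hf : IsUTilde f) (hg : IsUTilde g) : Set.EqOn f g gasketPlus := by
  intro z hz
  induction z, hz using gasketPlus_induction generalizing f g with
  | zero => exact (hf.row_zero 0 le_rfl).trans (hg.row_zero 0 le_rfl).symm
  | double p _ _ ih => linarith [ih hf.half hg.half]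
  | midpoint c hc p hp q hq hpq ih =>
    have hz := hc.add_mem_gasketPlus hp hq
    obtain hz2 | hz2 := le_or_gt (p + q).2 1
    · rw [hf.eq_two_mul_snd hz hz2, hg.eq_two_mul_snd hz hz2]
    have half_eq : ∀ r ∈ gasketTriangle c, f (r + r) / 5 = g (r + r) / 5 := fun r hr =>
      ih r hr (hc.gasketNorm_corner_lt hp hq hpq hz2 hr) hf.half hg.half
    rw [hf.isRefinement_half.midpoint c hc p hp q hq hpq,
      hg.isRefinement_half.midpoint c hc p hp q hq hpq, Finset.sum_congr rfl half_eq,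
      half_eq p hp, half_eq q hq]

theorem isRefinement_self (h : IsUTilde f) : IsRefinement f f where
  double p hp := by rw [← h.half.eqOn h hp]; ring
  midpoint c hc p hp q hq hpq := by
    have half_eq : ∀ r ∈ gasketTriangle c, f (r + r) / 5 = f r := fun r hr =>
      h.half.eqOn h (hc.mem_gasketPlus hr)
    rw [h.isRefinement_half.midpoint c hc p hp q hq hpq, Finset.sum_congr rfl half_eq,
      half_eq p hp, half_eq q hq]

theorem two_le (h : IsUTilde f) (hz : z ∈ gasketPlus) (hz2 : 1 ≤ z.2) : 2 ≤ f z := by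
  induction z, hz using gasketPlus_induction with
  | zero => simp at hz2
  | double p hp _ ih =>
    rw [h.isRefinement_self.double p hp]
    linarith [ih (by rw [Prod.snd_add] at hz2; omega)]
  | midpoint c hc p hp q hq hpq ih =>
    obtain hz1 | hz1 := hz2.eq_or_lt
    · rw [h.eq_two_mul_snd (hc.add_mem_gasketPlus hp hq) hz1.ge, ← hz1]
      norm_num
    have corner : ∀ r ∈ gasketTriangle c, 2 ≤ f r := fun r hr =>
      ih r hr (hc.gasketNorm_corner_lt hp hq hpq hz1 hr) <| by
        rw [ne_eq, Prod.ext_iff] at hpq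
        rw [mem_gasketTriangle] at hr hp hq
        rw [Prod.snd_add] at hz1
        have := hc.nonneg
        omega
    rw [h.isRefinement_self.midpoint c hc p hp q hq hpq]
    linarith [corner p hp, corner q hq,
      Finset.sum_nonneg fun r hr => zero_le_two.trans (corner r hr)]

end IsUTilde

/-- The function `ũ`: it vanishes on the bottom row, is `2` on the next row, and refines
itself (`isRefinement_uTilde`). The values at `z.1 < 0` are irrelevant and only make the recursion
terminate. -/
noncomputable def uTilde (z : ℤ × ℤ) : ℝ :=
  if z.1 < 0 ∨ z.2 ≤ 1 then 2 * z.2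
  else if z.1 % 2 = 0 ∧ z.2 % 2 = 0 then 5 * uTilde (z.1 / 2, z.2 / 2)
  else uTilde (z.1 / 2, z.2 / 2) + (uTilde (z.1 / 2 + 1, z.2 / 2) + uTilde (z.1 / 2, z.2 / 2 + 1))
    + uTilde (z.1 / 2, (z.2 + 1) / 2) + uTilde ((z.1 + 1) / 2, z.2 / 2) - 2
termination_by gasketNorm z
decreasing_by all_goals simp only [gasketNorm]; omega

theorem uTilde_of_snd_le_one {z : ℤ × ℤ} (hz : z.2 ≤ 1) : uTilde z = 2 * z.2 := by
  rw [uTilde, if_pos (.inr hz)]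

theorem uTilde_add_self {p : ℤ × ℤ} (hp : p ∈ gasketPlus) : uTilde (p + p) = 5 * uTilde p := by
  have hnonneg := nonneg_of_mem_gasketPlus hp
  obtain hp2 | hp2 := hnonneg.2.eq_or_lt
  · simp [uTilde_of_snd_le_one, ← hp2]
  · rw [uTilde, if_neg (by rw [Prod.fst_add, Prod.snd_add]; omega), if_pos (by
      rw [Prod.fst_add, Prod.snd_add]
      omega)]
    congr 2
    ext <;> simp only [Prod.fst_add, Prod.snd_add] <;> omega

theorem uTilde_midpoint {c p q : ℤ × ℤ} (hc : GasketCell c) (hp : p ∈ gasketTriangle c)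
    (hq : q ∈ gasketTriangle c) (hpq : p ≠ q) :
    uTilde (p + q) = ∑ r ∈ gasketTriangle c, uTilde r + uTilde p + uTilde q - 2 := by
  have hnonneg := hc.nonneg
  rw [mem_gasketTriangle] at hp hq
  rw [ne_eq, Prod.ext_iff] at hpq
  rw [sum_gasketTriangle]
  obtain h2 | h2 := le_or_gt (p + q).2 1
  · rw [Prod.snd_add] at h2
    have hc2 : c.2 = 0 := by omega
    rw [uTilde_of_snd_le_one (z := p + q) h2, uTilde_of_snd_le_one (z := p) (by omega),
      uTilde_of_snd_le_one (z := q) (by omega)]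
    simp only [Prod.snd_add, Int.cast_add, hc2, zero_le_one, uTilde_of_snd_le_one, Int.cast_zero,
      mul_zero, add_zero, zero_add, le_refl, Int.cast_one, mul_one]
    ring
  · have hodd : ¬((p + q).1 % 2 = 0 ∧ (p + q).2 % 2 = 0) := by
      simp only [Prod.fst_add, Prod.snd_add]
      omega
    have hnot : ¬((p + q).1 < 0 ∨ (p + q).2 ≤ 1) := by
      rw [Prod.fst_add]
      omega
    have hfst : (p + q).1 / 2 = c.1 := by rw [Prod.fst_add]; omega
    have hsnd : (p + q).2 / 2 = c.2 := by rw [Prod.snd_add]; omega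
    have hends : (c.1, ((p + q).2 + 1) / 2) = p ∧ (((p + q).1 + 1) / 2, c.2) = q ∨
        (c.1, ((p + q).2 + 1) / 2) = q ∧ (((p + q).1 + 1) / 2, c.2) = p := by
      simp only [Prod.ext_iff, Prod.fst_add, Prod.snd_add]
      omega
    have hright : c + (1, 0) = (c.1 + 1, c.2) := by simp [Prod.ext_iff]
    have hup : c + (0, 1) = (c.1, c.2 + 1) := by simp [Prod.ext_iff]
    rw [uTilde, if_neg hnot, if_neg hodd, hfst, hsnd, hright, hup]
    rcases hends with ⟨h, h'⟩ | ⟨h, h'⟩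
    · rw [h, h']
    · rw [h, h']
      ring

theorem isRefinement_uTilde : IsRefinement uTilde uTilde where
  double _ := uTilde_add_self
  midpoint _ hc _ hp _ hq := uTilde_midpoint hc hp hq

theorem cellLaplacian_uTilde {z : ℤ × ℤ} (hz : z ∈ gasketPlus) (h0 : z ≠ 0) :
    cellLaplacian uTilde z = 4 := by
  induction z, hz using gasketPlus_induction with
  | zero => exact absurd rfl h0
  | double p hp hp0 ih =>
    rw [isRefinement_uTilde.cellLaplacian_add_self hp hp0, ih hp0]
    norm_num
  | midpoint c hc p hp q hq hpq _ => exact isRefinement_uTilde.cellLaplacian_midpoint hc hp hq hpq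

theorem isUTilde_uTilde : IsUTilde uTilde :=
  .of_cellLaplacian_eq (fun x _ => by simp [uTilde_of_snd_le_one])
    (fun x _ _ => by simp [uTilde_of_snd_le_one]) fun _ => cellLaplacian_uTilde

/-! ### The odometer -/

section Rotation

variable {k : ℕ} {c q z : ℤ × ℤ}

theorem gasketPsi_succ_add (k : ℕ) (p q : ℤ × ℤ) :
    gasketPsi (k + 1) (p + q) = gasketPsi k p + gasketPsi k q := by
  ext
  · rfl
  · simp only [gasketPsi, Prod.fst_add, Prod.snd_add]
    ring

theorem gasketPsi_add_injective (k : ℕ) (d : ℤ × ℤ) :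
    Function.Injective fun c => gasketPsi k (c + d) := by
  intro p q h
  simp only [gasketPsi, Prod.ext_iff, Prod.fst_add, Prod.snd_add] at h ⊢
  omega

/-- `ψ_k` rotates the triangle with lower left corner `c`, and the lower right corner `c + (1, 0)`
becomes the lower left one. -/
theorem gasketPsi_mem_gasketTriangle_iff :
    gasketPsi k q ∈ gasketTriangle (gasketPsi k (c + (1, 0))) ↔ q ∈ gasketTriangle c := by
  simp only [mem_gasketTriangle, gasketPsi, Prod.fst_add, Prod.snd_add]
  omega

theorem sum_gasketTriangle_gasketPsi {M : Type*} [AddCommMonoid M] (f : ℤ × ℤ → M) (k : ℕ)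
    (c : ℤ × ℤ) : ∑ q ∈ gasketTriangle (gasketPsi k (c + (1, 0))), f q =
      ∑ q ∈ gasketTriangle c, f (gasketPsi k q) := by
  have hright : gasketPsi k (c + (1, 0)) + (1, 0) = gasketPsi k (c + (0, 1)) := by
    ext <;> simp only [gasketPsi, Prod.fst_add, Prod.snd_add] <;> ring
  have hup : gasketPsi k (c + (1, 0)) + (0, 1) = gasketPsi k c := by
    ext <;> simp only [gasketPsi, Prod.fst_add, Prod.snd_add] <;> ring
  rw [sum_gasketTriangle, sum_gasketTriangle, hright, hup, add_comm (f (gasketPsi k (c + (0, 1)))),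
    add_left_comm]

theorem gasketPsi_mem_gasketLevelCells (hc : c ∈ gasketLevelCells k) :
    gasketPsi k (c + (1, 0)) ∈ gasketLevelCells k := by
  induction k generalizing c with
  | zero =>
    rw [gasketLevelCells_zero, Set.mem_singleton_iff] at hc ⊢
    subst hc
    rfl
  | succ k ih =>
    obtain ⟨d, hd, p, hp, rfl⟩ := mem_gasketLevelCells_succ_iff.1 hc
    rw [add_right_comm, gasketPsi_succ_add]
    exact mem_gasketLevelCells_succ_iff.2
      ⟨_, ih hd, _, gasketPsi_mem_gasketTriangle_iff.2 hp, rfl⟩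

theorem mem_gasketLevelCells_of_mem_gasketCellsAt (hc : c ∈ gasketCellsAt z)
    (hz : gasketNorm z < 2 ^ k) : c ∈ gasketLevelCells k := by
  rw [mem_gasketCellsAt, mem_gasketTriangle] at hc
  refine ⟨hc.1, ?_⟩
  zify at hz
  have := hc.1.nonneg
  simp only [gasketNorm] at hz
  omega

theorem gasketPsi_mem_gasketCellsAt (hc : c ∈ gasketCellsAt z) (hz : gasketNorm z < 2 ^ k) :
    gasketPsi k (c + (1, 0)) ∈ gasketCellsAt (gasketPsi k z) :=
  mem_gasketCellsAt.2
    ⟨(gasketPsi_mem_gasketLevelCells (mem_gasketLevelCells_of_mem_gasketCellsAt hc hz)).1,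
      gasketPsi_mem_gasketTriangle_iff.2 (mem_gasketCellsAt.1 hc).2⟩

theorem gasketPsi_mem_gasketPlus (hz : z ∈ gasketPlus) (hlt : gasketNorm z < 2 ^ k) :
    gasketPsi k z ∈ gasketPlus := by
  rw [← gasketCellsAt_nonempty_iff] at hz ⊢
  obtain ⟨c, hc⟩ := hz
  exact ⟨_, gasketPsi_mem_gasketCellsAt hc hlt⟩

theorem one_le_gasketPsi_snd (hz : gasketNorm z < 2 ^ k) : 1 ≤ (gasketPsi k z).2 := by
  zify at hz
  simp only [gasketNorm, gasketPsi] at hz ⊢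
  omega

theorem gasketPsi_ne_zero (hz : gasketNorm z < 2 ^ k) : gasketPsi k z ≠ 0 := fun h => by
  have := one_le_gasketPsi_snd hz
  simp [h] at this

theorem gasketCellsAt_gasketPsi (hz : z ∈ gasketPlus) (h0 : z ≠ 0) (hlt : gasketNorm z < 2 ^ k) :
    gasketCellsAt (gasketPsi k z) =
      (gasketCellsAt z).image fun c => gasketPsi k (c + (1, 0)) := by
  symm
  refine Finset.eq_of_subset_of_card_le
    (Finset.image_subset_iff.2 fun c hc => gasketPsi_mem_gasketCellsAt hc hlt) ?_
  rw [Finset.card_image_of_injective _ (gasketPsi_add_injective k _), card_gasketCellsAt hz h0,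
    card_gasketCellsAt (gasketPsi_mem_gasketPlus hz hlt) (gasketPsi_ne_zero hlt)]

theorem cellLaplacian_gasketPsi (f : ℤ × ℤ → ℝ) (hz : z ∈ gasketPlus) (h0 : z ≠ 0)
    (hlt : gasketNorm z < 2 ^ k) :
    cellLaplacian f (gasketPsi k z) = cellLaplacian (fun q => f (gasketPsi k q)) z := by
  rw [cellLaplacian, gasketCellsAt_gasketPsi hz h0 hlt, 
    Finset.sum_image (gasketPsi_add_injective k _).injOn, cellLaplacian]
  simp only [sum_gasketTriangle_gasketPsi]

end Rotation

/-- The claimed odometer of `3^(k+1)` grains at the origin, as a function on `ℤ × ℤ`; `f` is to be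
`ũ`. -/
noncomputable def gasketOdometer (f : ℤ × ℤ → ℝ) (k : ℕ) (z : ℤ × ℤ) : ℝ :=
  if gasketNorm z ≤ 2 ^ k then f (gasketPsi k (|z.1|, |z.2|)) else 0

section Odometer

variable {f : ℤ × ℤ → ℝ} {k : ℕ} {c z : ℤ × ℤ}

theorem gasketOdometer_neg (f : ℤ × ℤ → ℝ) (k : ℕ) (z : ℤ × ℤ) :
    gasketOdometer f k (-z) = gasketOdometer f k z := by
  simp only [gasketOdometer, gasketNorm_neg, Prod.fst_neg, Prod.snd_neg, abs_neg]

theorem gasketOdometer_of_mem_gasketPlus (f : ℤ × ℤ → ℝ) (hz : z ∈ gasketPlus)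
    (hle : gasketNorm z ≤ 2 ^ k) : gasketOdometer f k z = f (gasketPsi k z) := by
  have hnonneg := nonneg_of_mem_gasketPlus hz
  rw [gasketOdometer, if_pos hle, abs_of_nonneg hnonneg.1, abs_of_nonneg hnonneg.2]

theorem abs_mem_gasketPlus (z : Gasket) :
    (|(z : ℤ × ℤ).1|, |(z : ℤ × ℤ).2|) ∈ gasketPlus := by
  rcases z.2 with hz | hz
  · have hnonneg := nonneg_of_mem_gasketPlus hz
    rwa [abs_of_nonneg hnonneg.1, abs_of_nonneg hnonneg.2]
  · have hnonneg := nonneg_of_mem_gasketPlus hz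
    rw [Prod.fst_neg, Prod.snd_neg] at hnonneg
    rwa [abs_of_nonpos (neg_nonneg.1 hnonneg.1), abs_of_nonpos (neg_nonneg.1 hnonneg.2)]

theorem gasketNorm_abs (z : ℤ × ℤ) : gasketNorm (|z.1|, |z.2|) = gasketNorm z := by
  simp only [gasketNorm, Int.natAbs_abs]

namespace IsUTilde

theorem gasketOdometer_eq_zero (h : IsUTilde f) (hz : 2 ^ k ≤ gasketNorm z) :
    gasketOdometer f k z = 0 := by
  rw [gasketOdometer]
  split_ifs with hle
  · have hnorm : |z.1| + |z.2| = 2 ^ k := by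
      have heq := le_antisymm hle hz
      rw [gasketNorm] at heq
      zify at heq
      exact heq
    rw [gasketPsi, sub_sub, hnorm, sub_self, h.row_zero _ (abs_nonneg _)]
  · rfl

theorem two_le_gasketOdometer (h : IsUTilde f) {z : Gasket} (hz : gasketNorm z < 2 ^ k) :
    2 ≤ gasketOdometer f k z := by
  rw [← gasketNorm_abs] at hz
  rw [gasketOdometer, if_pos (gasketNorm_abs z ▸ hz.le)]
  exact h.two_le (gasketPsi_mem_gasketPlus (abs_mem_gasketPlus z) hz) (one_le_gasketPsi_snd hz)

theorem gasketOdometer_pos_iff (h : IsUTilde f) {z : Gasket} :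
    0 < gasketOdometer f k z ↔ gasketNorm z < 2 ^ k := by
  refine ⟨fun hpos => ?_, fun hz => two_pos.trans_le (h.two_le_gasketOdometer hz)⟩
  by_contra! hz
  exact hpos.ne' (h.gasketOdometer_eq_zero hz)

theorem gasketOdometer_nonneg (h : IsUTilde f) (z : Gasket) : 0 ≤ gasketOdometer f k z := by
  obtain hz | hz := lt_or_ge (gasketNorm z) (2 ^ k)
  · exact zero_le_two.trans (h.two_le_gasketOdometer hz)
  · exact (h.gasketOdometer_eq_zero hz).ge

end IsUTilde

theorem gasketOdometer_of_mem_gasketTriangle (f : ℤ × ℤ → ℝ) (hc : c ∈ gasketLevelCells k)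
    (hz : z ∈ gasketTriangle c) : gasketOdometer f k z = f (gasketPsi k z) := by
  refine gasketOdometer_of_mem_gasketPlus f (hc.1.mem_gasketPlus hz) ?_
  have hlt := hc.2
  have := hc.1.nonneg
  rw [mem_gasketTriangle] at hz
  zify
  simp only [gasketNorm]
  omega

theorem sum_gasketTriangle_gasketOdometer (f : ℤ × ℤ → ℝ) (hc : c ∈ gasketLevelCells k) :
    ∑ q ∈ gasketTriangle c, gasketOdometer f k q =
      ∑ q ∈ gasketTriangle (gasketPsi k (c + (1, 0))), f q := by
  rw [sum_gasketTriangle_gasketPsi]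
  exact Finset.sum_congr rfl fun q hq => gasketOdometer_of_mem_gasketTriangle f hc hq

namespace IsUTilde

theorem cellLaplacian_gasketOdometer_of_lt (h : IsUTilde f) (hz : z ∈ gasketPlus) (h0 : z ≠ 0)
    (hlt : gasketNorm z < 2 ^ k) : cellLaplacian (gasketOdometer f k) z = 4 := by
  rw [cellLaplacian_congr fun c hc q hq => gasketOdometer_of_mem_gasketTriangle f
      (mem_gasketLevelCells_of_mem_gasketCellsAt hc hlt) hq, ← cellLaplacian_gasketPsi f hz h0 hlt]
  exact h.cellLaplacian_eq (gasketPsi_mem_gasketPlus hz hlt) (gasketPsi_ne_zero hlt)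

/-- `ψ_k` maps the triangles of the ball that touch its boundary to the bottom row. -/
theorem sum_gasketTriangle_gasketOdometer_le (h : IsUTilde f) (hc : GasketCell c)
    (hlt : 2 ^ k ≤ c.1 + c.2 + 1) : ∑ q ∈ gasketTriangle c, gasketOdometer f k q ≤ 2 := by
  obtain hlt' | hle := lt_or_ge (c.1 + c.2) (2 ^ k)
  · rw [sum_gasketTriangle_gasketOdometer f ⟨hc, hlt'⟩, h.sum_gasketTriangle_bottom
      (gasketPsi_mem_gasketLevelCells ⟨hc, hlt'⟩).1]
    simp only [gasketPsi, Prod.fst_add, Prod.snd_add]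
    omega
  · rw [Finset.sum_eq_zero fun q hq => h.gasketOdometer_eq_zero ?_]
    · exact zero_le_two
    have := hc.nonneg
    rw [mem_gasketTriangle] at hq
    zify
    simp only [gasketNorm]
    omega

theorem cellLaplacian_gasketOdometer_le (h : IsUTilde f) (hz : z ∈ gasketPlus) (h0 : z ≠ 0) :
    cellLaplacian (gasketOdometer f k) z ≤ 4 := by
  obtain hlt | hle := lt_or_ge (gasketNorm z) (2 ^ k)
  · exact (h.cellLaplacian_gasketOdometer_of_lt hz h0 hlt).le
  have hcell : ∀ c ∈ gasketCellsAt z,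
      ∑ q ∈ gasketTriangle c, gasketOdometer f k q - 3 * gasketOdometer f k z ≤ 2 := by
    intro c hc
    rw [h.gasketOdometer_eq_zero hle, mul_zero, sub_zero]
    rw [mem_gasketCellsAt, mem_gasketTriangle] at hc
    refine h.sum_gasketTriangle_gasketOdometer_le hc.1 ?_
    have := hc.1.nonneg
    zify at hle
    simp only [gasketNorm] at hle
    omega
  refine (Finset.sum_le_sum hcell).trans_eq ?_
  rw [Finset.sum_const, card_gasketCellsAt hz h0]
  norm_num

theorem sum_gasketTriangle_gasketPsi_zero (h : IsUTilde f) (k : ℕ) :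
    ∑ q ∈ gasketTriangle (gasketPsi k (0 + (1, 0))), f q - 3 * f (gasketPsi k 0) =
      2 - 2 * 3 ^ (k + 1) := by
  induction k with
  | zero =>
    have hcorner : f (gasketPsi 0 0) = 2 :=
      h.row_one 0 le_rfl (GasketCell.zero.mem_gasketPlus (by simp [gasketTriangle]))
    have hcell : gasketPsi 0 (0 + (1, 0)) = 0 := rfl
    rw [hcell, h.sum_gasketTriangle_bottom .zero rfl, hcorner]
    norm_num
  | succ k ih =>
    have hzero : (0 : ℤ × ℤ) ∈ gasketLevelCells k := ⟨.zero, by simp⟩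
    have hcell := gasketPsi_mem_gasketLevelCells hzero
    have hcorner : gasketPsi k 0 ∈ gasketTriangle (gasketPsi k (0 + (1, 0))) :=
      gasketPsi_mem_gasketTriangle_iff.2 (self_mem_gasketTriangle 0)
    have hpsi : gasketPsi (k + 1) 0 = gasketPsi k 0 + gasketPsi k 0 := gasketPsi_succ_add k 0 0
    have hpsi' : gasketPsi (k + 1) (0 + (1, 0)) = gasketPsi k (0 + (1, 0)) + gasketPsi k 0 := by
      rw [← gasketPsi_succ_add, add_zero]
    rw [hpsi, hpsi', h.isRefinement_self.sum_gasketTriangle_add_sub hcell.1 hcorner, ih]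
    ring

theorem cellLaplacian_gasketOdometer_zero (h : IsUTilde f) (k : ℕ) :
    cellLaplacian (gasketOdometer f k) 0 = 2 - 2 * 3 ^ (k + 1) := by
  have hzero : (0 : ℤ × ℤ) ∈ gasketLevelCells k := ⟨.zero, by simp⟩
  rw [cellLaplacian, gasketCellsAt_zero, Finset.sum_singleton,
    sum_gasketTriangle_gasketOdometer f hzero,
    gasketOdometer_of_mem_gasketTriangle f hzero (self_mem_gasketTriangle 0),
    h.sum_gasketTriangle_gasketPsi_zero]

end IsUTilde

theorem four_mul_gasketLaplacian_gasketOdometer (f : ℤ × ℤ → ℝ) (k : ℕ) (z : Gasket) :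
    4 * gasketLaplacian (fun w => gasketOdometer f k w) z =
      cellLaplacian (gasketOdometer f k) z + cellLaplacian (gasketOdometer f k) (-z) := by
  rw [four_mul_gasketLaplacian]
  simp only [gasketOdometer_neg]

theorem exists_four_mul_gasketLaplacian_gasketOdometer_eq (f : ℤ × ℤ → ℝ) (k : ℕ) {z : Gasket}
    (h0 : (z : ℤ × ℤ) ≠ 0) : ∃ p ∈ gasketPlus, p ≠ 0 ∧ gasketNorm p = gasketNorm z ∧
      4 * gasketLaplacian (fun w => gasketOdometer f k w) z =
        cellLaplacian (gasketOdometer f k) p := by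
  rw [four_mul_gasketLaplacian_gasketOdometer]
  rcases z.2 with hz | hz
  · refine ⟨z, hz, h0, rfl, add_eq_left.2 ?_⟩
    rw [cellLaplacian, gasketCellsAt_neg_eq_empty hz h0, Finset.sum_empty]
  · refine ⟨-z, hz, neg_ne_zero.2 h0, gasketNorm_neg _, add_eq_right.2 ?_⟩
    have hempty := gasketCellsAt_neg_eq_empty hz (neg_ne_zero.2 h0)
    rw [cellLaplacian, ← neg_neg (z : ℤ × ℤ), hempty, Finset.sum_empty]

namespace IsUTilde

theorem gasketLaplacian_gasketOdometer_origin (h : IsUTilde f) (k : ℕ) :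
    gasketLaplacian (fun w => gasketOdometer f k w) gasketOrigin = 1 - 3 ^ (k + 1) := by
  have hlap := four_mul_gasketLaplacian_gasketOdometer f k gasketOrigin
  rw [show (gasketOrigin : ℤ × ℤ) = 0 from rfl, neg_zero,
    h.cellLaplacian_gasketOdometer_zero] at hlap
  linarith

theorem gasketLaplacian_gasketOdometer_le (h : IsUTilde f) (k : ℕ) {z : Gasket}
    (h0 : (z : ℤ × ℤ) ≠ 0) : gasketLaplacian (fun w => gasketOdometer f k w) z ≤ 1 := by
  obtain ⟨p, hp, hp0, -, hlap⟩ := exists_four_mul_gasketLaplacian_gasketOdometer_eq f k h0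
  linarith [h.cellLaplacian_gasketOdometer_le (k := k) hp hp0]

theorem gasketLaplacian_gasketOdometer_eq_one (h : IsUTilde f) {z : Gasket}
    (h0 : (z : ℤ × ℤ) ≠ 0) (hz : gasketNorm z < 2 ^ k) :
    gasketLaplacian (fun w => gasketOdometer f k w) z = 1 := by
  obtain ⟨p, hp, hp0, hnorm, hlap⟩ := exists_four_mul_gasketLaplacian_gasketOdometer_eq f k h0
  linarith [h.cellLaplacian_gasketOdometer_of_lt hp hp0 (hnorm ▸ hz)]

theorem sandpileCluster_gasketOdometer (h : IsUTilde f) (k : ℕ) :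
    sandpileCluster (fun z => gasketOdometer f k z) = gasketBall (2 ^ k - 1) := by
  ext z
  rw [mem_gasketBall_iff, ← Nat.lt_iff_le_pred (by positivity)]
  exact h.gasketOdometer_pos_iff

theorem isOdometer_gasketOdometer (h : IsUTilde f) (k : ℕ) :
    IsOdometer ((3 : ℝ) ^ (k + 1) • gasketDelta gasketOrigin)
      fun z => gasketOdometer f k z := by
  have horigin : ((3 : ℝ) ^ (k + 1) • gasketDelta gasketOrigin) gasketOrigin +
      gasketLaplacian (fun w => gasketOdometer f k w) gasketOrigin = 1 := by
    simp [h.gasketLaplacian_gasketOdometer_origin, gasketDelta]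
  have hdelta : ∀ {z}, z ≠ gasketOrigin →
      ((3 : ℝ) ^ (k + 1) • gasketDelta gasketOrigin) z = 0 := fun hz => by
    simp [gasketDelta, hz]
  refine isOdometer_of_stabilizing (fun z => h.gasketOdometer_nonneg z) ?_ (fun z => ?_)
    fun z hpos => ?_
  · rw [h.sandpileCluster_gasketOdometer]
    exact gasketBall_finite _
  · obtain rfl | hz := eq_or_ne z gasketOrigin
    · exact horigin.le
    · rw [hdelta hz, zero_add]
      exact h.gasketLaplacian_gasketOdometer_le k (Subtype.coe_ne_coe.2 hz)
  · obtain rfl | hz := eq_or_ne z gasketOrigin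
    · exact horigin
    · rw [hdelta hz, zero_add]
      exact h.gasketLaplacian_gasketOdometer_eq_one (Subtype.coe_ne_coe.2 hz)
        (h.gasketOdometer_pos_iff.1 hpos)

end IsUTilde

end Odometer

open Classical in
theorem mainTheorem3 :
    (∃ ut : ℤ × ℤ → ℝ, IsUTilde ut ∧ ∀ f, IsUTilde f → Set.EqOn f ut gasketPlus) ∧
    ∀ ut : ℤ × ℤ → ℝ, IsUTilde ut → ∀ k : ℕ,
      ∃ u : Gasket → ℝ, IsOdometer ((3 : ℝ) ^ (k + 1) • gasketDelta gasketOrigin) u ∧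
        (∀ z : Gasket, u z =
          if z ∈ gasketBall (2 ^ k) then
            ut (gasketPsi k (|(z : ℤ × ℤ).1|, |(z : ℤ × ℤ).2|))
          else 0) ∧
        sandpileCluster u = gasketBall (2 ^ k - 1) := by
  refine ⟨⟨uTilde, isUTilde_uTilde, fun f hf => hf.eqOn isUTilde_uTilde⟩, fun ut hut k => ?_⟩
  refine ⟨fun z => gasketOdometer ut k z, hut.isOdometer_gasketOdometer k, fun z => ?_,
    hut.sandpileCluster_gasketOdometer k⟩
  simp only [mem_gasketBall_iff, gasketOdometer]
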